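/- Let $(M,g,J)$ and $(\overline M,\bar g,\bar J)$ be connected smooth manifolds of real dimension $2n\ge 4$ with indefinite Kähler structures: $g$ is a smooth nondegenerate indefinite metric, $J$ is a smooth almost complex structure with $g(Jx,Jy)=g(x,y)$ and $\nabla J=0$ for the Levi-Civita connection $\nabla$ of $g$, and likewise for $\overline M$. For a vector $x$ with $g(x,x)\neq 0$ let $$H(x)=\frac{R(x,Jx,Jx,x)}{g(x,x)^2}$$ be the curvature of the holomorphic plane spanned by $x$ and $Jx$, where $R$ is the curvature tensor of $g$, and let $\overline H$ be the corresponding function for $\overline M$. A tangent vector $\xi\neq 0$ is called isotropic if $g(\xi,\xi)=0$; a real 2-plane $\alpha$ in a tangent space is called holomorphic if $J\alpha=\alpha$. Let $f:M\to\overline M$ be a diffeomorphism that maps every holomorphic plane to a holomorphic plane, and suppose that for every $p\in M$ and every isotropic vector $\xi\in T_pM$ $$\lim_{x\to\xi}\frac{\overline H(f_*x)}{H(x)}=1,$$ where $x$ runs over the vectors of $T_pM$ with $g(x,x)\ne0$, $\bar g(f_*x,f_*x)\neq 0$ and $H(x)\neq0$ (so that the ratio is defined). If $M$ is nowhere of constant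 holomorphic sectional curvature, i.e. the set of points $p\in M$ at which $H$ is not constant on the vectors $x\in T_pM$ with $g(x,x)\ne0$ is dense in $M$, then $f$ is an isometry ($f^*\bar g=g$), and it is holomorphic ($f_*J=\bar J f_*$) or antiholomorphic ($f_*J=-\bar J f_*$). -/

import Mathlib

open scoped Manifold ContDiff Topology
open Filter Bundle

noncomputable section

/-! ### Levi-Civita connection and curvature of a (pseudo-)metric in coordinates -/

namespace LocalMetric

variable {E : Type*} [NormedAddCommGroup E] [NormedSpace ℝ E]

/-- Christoffel symbols `Γ_y(v, w)` of the Levi-Civita connection of a metric `G` given in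
coordinates: the vector determined by Koszul's formula
`G_y(Γ_y(v, w), u) = (1/2) (D_v G(w, u) + D_w G(v, u) - D_u G(v, w))`. -/
def christoffel (G : E → E →L[ℝ] E →L[ℝ] ℝ) (y v w : E) : E :=
  (G y).inverse ((1 / 2 : ℝ) •
    (fderiv ℝ G y v w + fderiv ℝ G y w v - ((fderiv ℝ G y).flip v).flip w))

/-- The curvature operator `R(x, y)z = ∇_x ∇_y z - ∇_y ∇_x z` at the point `q`, where `x`, `y`, `z`
are coordinate (that is, constant) vector fields. -/
def curvatureOperator (G : E → E →L[ℝ] E →L[ℝ] ℝ) (q x y z : E) : E :=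
  fderiv ℝ (fun q' => christoffel G q' y z) q x - fderiv ℝ (fun q' => christoffel G q' x z) q y
    + christoffel G q x (christoffel G q y z) - christoffel G q y (christoffel G q x z)

/-- The covariant derivative `(∇_v A) w` at `q` of a field `A` of endomorphisms, with respect to the
Levi-Civita connection of `G`. -/
def covDerivEnd (G : E → E →L[ℝ] E →L[ℝ] ℝ) (A : E → E →L[ℝ] E) (q v w : E) : E :=
  fderiv ℝ A q v w + christoffel G q v (A q w) - A q (christoffel G q v w)

end LocalMetric

/-! ### Tensor fields on a manifold, read in charts -/

namespace PseudoRiemannian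

variable {E : Type*} [NormedAddCommGroup E] [NormedSpace ℝ E]
  {M : Type*} [TopologicalSpace M] [ChartedSpace E M]

/-- The coordinate expression of the metric `g` in the preferred chart at `p`, i.e. the pull-back
of `g` by the inverse of the chart. -/
def metricInChart
    (g : ∀ p : M, TangentSpace 𝓘(ℝ, E) p →L[ℝ] TangentSpace 𝓘(ℝ, E) p →L[ℝ] ℝ)
    (p : M) (y : E) : E →L[ℝ] E →L[ℝ] ℝ :=
  ContinuousLinearMap.bilinearComp (E := E) (F := E) (E' := E) (F' := E)
    (g ((extChartAt 𝓘(ℝ, E) p).symm y))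
    (mfderiv 𝓘(ℝ, E) 𝓘(ℝ, E) (extChartAt 𝓘(ℝ, E) p).symm y)
    (mfderiv 𝓘(ℝ, E) 𝓘(ℝ, E) (extChartAt 𝓘(ℝ, E) p).symm y)

/-- The coordinate expression of a field `A` of endomorphisms in the preferred chart at `p`. -/
def endInChart (A : ∀ p : M, TangentSpace 𝓘(ℝ, E) p →L[ℝ] TangentSpace 𝓘(ℝ, E) p)
    (p : M) (y : E) : E →L[ℝ] E :=
  (mfderiv 𝓘(ℝ, E) 𝓘(ℝ, E) (extChartAt 𝓘(ℝ, E) p) ((extChartAt 𝓘(ℝ, E) p).symm y)).comp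
    ((A ((extChartAt 𝓘(ℝ, E) p).symm y)).comp
      (mfderiv 𝓘(ℝ, E) 𝓘(ℝ, E) (extChartAt 𝓘(ℝ, E) p).symm y))

/-- `∇A = 0` for the Levi-Civita connection `∇` of `g`; the condition at `p` is written in the
preferred chart at `p`. -/
def IsParallelEnd
    (g : ∀ p : M, TangentSpace 𝓘(ℝ, E) p →L[ℝ] TangentSpace 𝓘(ℝ, E) p →L[ℝ] ℝ)
    (A : ∀ p : M, TangentSpace 𝓘(ℝ, E) p →L[ℝ] TangentSpace 𝓘(ℝ, E) p) : Prop :=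
  ∀ (p : M) (v w : E), LocalMetric.covDerivEnd (metricInChart g p) (endInChart A p)
    (extChartAt 𝓘(ℝ, E) p p) v w = 0

/-- The Riemannian curvature tensor `R(x, y, z, w) = g(R(x, y)z, w)` of `g` at `p`. -/
def curvatureTensor
    (g : ∀ p : M, TangentSpace 𝓘(ℝ, E) p →L[ℝ] TangentSpace 𝓘(ℝ, E) p →L[ℝ] ℝ)
    (p : M) (x y z w : TangentSpace 𝓘(ℝ, E) p) : ℝ :=
  metricInChart g p (extChartAt 𝓘(ℝ, E) p p)
    (LocalMetric.curvatureOperator (metricInChart g p) (extChartAt 𝓘(ℝ, E) p p)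
      (mfderiv 𝓘(ℝ, E) 𝓘(ℝ, E) (extChartAt 𝓘(ℝ, E) p) p x)
      (mfderiv 𝓘(ℝ, E) 𝓘(ℝ, E) (extChartAt 𝓘(ℝ, E) p) p y)
      (mfderiv 𝓘(ℝ, E) 𝓘(ℝ, E) (extChartAt 𝓘(ℝ, E) p) p z))
    (mfderiv 𝓘(ℝ, E) 𝓘(ℝ, E) (extChartAt 𝓘(ℝ, E) p) p w)

/-- The tensor `π₁(z, u, v, w) = g(z, w) g(u, v) - g(z, v) g(u, w)`. -/
def piOne
    (g : ∀ p : M, TangentSpace 𝓘(ℝ, E) p →L[ℝ] TangentSpace 𝓘(ℝ, E) p →L[ℝ] ℝ)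
    (p : M) (z u v w : TangentSpace 𝓘(ℝ, E) p) : ℝ :=
  g p z w * g p u v - g p z v * g p u w

/-- The curvature of the (nondegenerate) plane with basis `x, y`. -/
def sectionalCurvature
    (g : ∀ p : M, TangentSpace 𝓘(ℝ, E) p →L[ℝ] TangentSpace 𝓘(ℝ, E) p →L[ℝ] ℝ)
    (p : M) (x y : TangentSpace 𝓘(ℝ, E) p) : ℝ :=
  curvatureTensor g p x y y x / piOne g p x y y x

end PseudoRiemannian

/-! ### Indefinite Kähler manifolds -/

/-- A smooth indefinite Kähler structure on a smooth manifold `M`: an indefinite pseudo-Riemannian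
metric `g` and a `g`-orthogonal almost complex structure `J` with `∇J = 0`. -/
structure IndefiniteKahler (E : Type*) [NormedAddCommGroup E] [NormedSpace ℝ E]
    (M : Type*) [TopologicalSpace M] [ChartedSpace E M] [IsManifold 𝓘(ℝ, E) ∞ M] where
  /-- the metric -/
  g (p : M) : TangentSpace 𝓘(ℝ, E) p →L[ℝ] TangentSpace 𝓘(ℝ, E) p →L[ℝ] ℝ
  /-- the almost complex structure -/
  J (p : M) : TangentSpace 𝓘(ℝ, E) p →L[ℝ] TangentSpace 𝓘(ℝ, E) p
  g_smooth : ContMDiff 𝓘(ℝ, E) (𝓘(ℝ, E).prod 𝓘(ℝ, E →L[ℝ] E →L[ℝ] ℝ)) ∞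
    (fun p : M => TotalSpace.mk' (E →L[ℝ] E →L[ℝ] ℝ)
      (E := fun p : M => TangentSpace 𝓘(ℝ, E) p →L[ℝ] TangentSpace 𝓘(ℝ, E) p →L[ℝ] ℝ) p (g p))
  J_smooth : ContMDiff 𝓘(ℝ, E) (𝓘(ℝ, E).prod 𝓘(ℝ, E →L[ℝ] E)) ∞
    (fun p : M => TotalSpace.mk' (E →L[ℝ] E)
      (E := fun p : M => TangentSpace 𝓘(ℝ, E) p →L[ℝ] TangentSpace 𝓘(ℝ, E) p) p (J p))
  g_symm (p : M) (x y : TangentSpace 𝓘(ℝ, E) p) : g p x y = g p y x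
  g_nondegenerate (p : M) (x : TangentSpace 𝓘(ℝ, E) p) : (∀ y, g p x y = 0) → x = 0
  g_neg (p : M) : ∃ x, g p x x < 0
  g_pos (p : M) : ∃ x, 0 < g p x x
  J_sq (p : M) (x : TangentSpace 𝓘(ℝ, E) p) : J p (J p x) = -x
  g_J (p : M) (x y : TangentSpace 𝓘(ℝ, E) p) : g p (J p x) (J p y) = g p x y
  J_parallel : PseudoRiemannian.IsParallelEnd g J

namespace IndefiniteKahler

variable {E : Type*} [NormedAddCommGroup E] [NormedSpace ℝ E]
  {M : Type*} [TopologicalSpace M] [ChartedSpace E M] [IsManifold 𝓘(ℝ, E) ∞ M]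
  {E' : Type*} [NormedAddCommGroup E'] [NormedSpace ℝ E']
  {M' : Type*} [TopologicalSpace M'] [ChartedSpace E' M'] [IsManifold 𝓘(ℝ, E') ∞ M']

/-- A vector is isotropic if it is nonzero and `g(ξ, ξ) = 0`. -/
def IsIsotropic (S : IndefiniteKahler E M) (p : M) (ξ : TangentSpace 𝓘(ℝ, E) p) : Prop :=
  S.g p ξ ξ = 0 ∧ ξ ≠ 0

/-- The holomorphic sectional curvature `H(x)`, i.e. the curvature of the holomorphic plane
spanned by `x` and `Jx`, for `g(x, x) ≠ 0`. -/
def holCurv (S : IndefiniteKahler E M) (p : M) (x : TangentSpace 𝓘(ℝ, E) p) : ℝ :=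
  PseudoRiemannian.sectionalCurvature S.g p x (S.J p x)

/-- All nondegenerate holomorphic planes at `p` have the same curvature. -/
def HasConstantHolCurvAt (S : IndefiniteKahler E M) (p : M) : Prop :=
  ∃ c : ℝ, ∀ x : TangentSpace 𝓘(ℝ, E) p, S.g p x x ≠ 0 → S.holCurv p x = c

/-- `α` is a holomorphic plane: a 2-dimensional subspace of the tangent space with `Jα = α`. -/
def IsHolomorphicPlane (S : IndefiniteKahler E M) (p : M)
    (α : Submodule ℝ (TangentSpace 𝓘(ℝ, E) p)) : Prop :=
  Module.finrank ℝ α = 2 ∧ α.map (S.J p).toLinearMap = α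

/-- The image under `f_*` of every holomorphic plane is a holomorphic plane. -/
def MapsHolomorphicPlanes (S : IndefiniteKahler E M) (S' : IndefiniteKahler E' M')
    (f : M → M') : Prop :=
  ∀ (p : M) (α : Submodule ℝ (TangentSpace 𝓘(ℝ, E) p)), S.IsHolomorphicPlane p α →
    S'.IsHolomorphicPlane (f p) (α.map (mfderiv 𝓘(ℝ, E) 𝓘(ℝ, E') f p).toLinearMap)

/-- The ratio `H'(f_* x) / H(x)` tends to `1` as `x` tends to `ξ` in the tangent space, where `x`
runs over the nonisotropic vectors with nonisotropic image for which the ratio is defined, that is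
for which `H(x) ≠ 0`. -/
def HolCurvRatioTendsToOne (S : IndefiniteKahler E M) (S' : IndefiniteKahler E' M')
    (f : M → M') (p : M) (ξ : TangentSpace 𝓘(ℝ, E) p) : Prop :=
  Tendsto
    (fun x : TangentSpace 𝓘(ℝ, E) p =>
      S'.holCurv (f p) (mfderiv 𝓘(ℝ, E) 𝓘(ℝ, E') f p x) / S.holCurv p x)
    (𝓝[{x | S.g p x x ≠ 0 ∧
        S'.g (f p) (mfderiv 𝓘(ℝ, E) 𝓘(ℝ, E') f p x) (mfderiv 𝓘(ℝ, E) 𝓘(ℝ, E') f p x) ≠ 0 ∧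
        S.holCurv p x ≠ 0}] ξ)
    (𝓝 1)

/-- `f_* ∘ J = J' ∘ f_*`. -/
def IsHolomorphic (S : IndefiniteKahler E M) (S' : IndefiniteKahler E' M') (f : M → M') : Prop :=
  ∀ (p : M) (x : TangentSpace 𝓘(ℝ, E) p),
    mfderiv 𝓘(ℝ, E) 𝓘(ℝ, E') f p (S.J p x) = S'.J (f p) (mfderiv 𝓘(ℝ, E) 𝓘(ℝ, E') f p x)

/-- `f_* ∘ J = -J' ∘ f_*`. -/
def IsAntiholomorphic (S : IndefiniteKahler E M) (S' : IndefiniteKahler E' M')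
    (f : M → M') : Prop :=
  ∀ (p : M) (x : TangentSpace 𝓘(ℝ, E) p),
    mfderiv 𝓘(ℝ, E) 𝓘(ℝ, E') f p (S.J p x) = -S'.J (f p) (mfderiv 𝓘(ℝ, E) 𝓘(ℝ, E') f p x)

/-- `f^* g' = g`. -/
def IsMetricPreserving (S : IndefiniteKahler E M) (S' : IndefiniteKahler E' M')
    (f : M → M') : Prop :=
  ∀ (p : M) (x y : TangentSpace 𝓘(ℝ, E) p),
    S'.g (f p) (mfderiv 𝓘(ℝ, E) 𝓘(ℝ, E') f p x) (mfderiv 𝓘(ℝ, E) 𝓘(ℝ, E') f p y) = S.g p x y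

end IndefiniteKahler

end

noncomputable section

set_option maxSynthPendingDepth 3
set_option linter.unusedSectionVars false

/-! ### Linear algebra of complex structures -/

section ComplexStructure

variable {V : Type*} [AddCommGroup V] [Module ℝ V] {J : V →ₗ[ℝ] V}

/-! Since `f_*` carries complex lines to complex lines and the complex dimension is at least two,
linear algebra gives `f_* J = ε J' f_*` at each point with `ε = ±1`
(`map_complexStructure_eq_or_eq_neg`). The two signs define complementary closed sets, so `ε` is
global by connectedness (`intertwines_or`).

At one point, write `H = P / g²` with the quartic `P x = R(x, Jx, Jx, x)`, and let `g'` be the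
pulled back metric, which is again `J`-Hermitian. Suppose some `g`-isotropic `ξ` has `g'(ξ, ξ) ≠ 0`.
Near `ξ` the curvature of the target stays bounded, while `H` has a double pole along `ξ + tη`
unless `P` vanishes to second order at `t = 0`; the ratio condition forces this vanishing
(`quartic_coeff_eq_zero`). Applied to both isotropic lines of a plane it leaves `P = k g²` on that
plane. A generic indefinite plane has two such lines, genericity being the nonvanishing of a
resultant, so the identity theorem makes `H` constant at the point. Where `H` is not constant, `g'`
therefore vanishes on the null cone of `g`, and this makes it a multiple of `g`
(`exists_eq_mul_of_ratio_tendsto_one`).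

Conformality is a closed condition, so density extends it to all of `M`: `f^* g' = c g`. The
fundamental forms then satisfy `f^* Ω' = ε c Ω`. Both are closed because `J` and `J'` are parallel,
hence `dc ∧ Ω = 0`, and `dc = 0` in real dimension greater than two (`hasFDerivAt_conformalFactor`).
Thus `f` is a homothety. It multiplies `P` by `c` and `H` by `1 / c`, and the ratio condition at one
point of nonconstant `H` gives `c = 1` (`homothety_factor_eq_one`). -/

theorem complexStructure_eq_zero_of_smul_add (hJ : ∀ x, J (J x) = -x) {x : V} {c d : ℝ}
    (h : c • x + d • J x = 0) (hx : x ≠ 0) : c = 0 ∧ d = 0 := by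
  have hJh : c • J x - d • x = 0 := by
    have := congrArg J h
    simp only [map_add, map_smul, hJ, map_zero] at this
    rw [← this]; module
  -- Apply the conjugate operator `c - d J` to the relation.
  have hs : (c ^ 2 + d ^ 2) • x = 0 := by linear_combination (norm := module) c • h - d • hJh
  have : c ^ 2 + d ^ 2 = 0 := (smul_eq_zero.1 hs).resolve_right hx
  constructor <;> nlinarith [sq_nonneg c, sq_nonneg d]

/-- If `c + d J` were nonzero it would be invertible, with inverse a multiple of `c - d J`, and the
relation would put `y` on the complex line of `x`. -/
theorem complexStructure_independent (hJ : ∀ x, J (J x) = -x) {x y : V} (hx : x ≠ 0)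
    (hy : ∀ a b : ℝ, y ≠ a • x + b • J x) {a b c d : ℝ}
    (h : a • x + b • J x + c • y + d • J y = 0) : a = 0 ∧ b = 0 := by
  have hJh : a • J x - b • x + c • J y - d • y = 0 := by
    have := congrArg J h
    simp only [map_add, map_smul, hJ, map_zero] at this
    rw [← this]; module
  have hs : (c ^ 2 + d ^ 2) • y = -(c * a + d * (-b)) • x - (c * b + d * a - 2 * d * a) • J x
      - (2 * d * b) • x := by
    linear_combination (norm := module) c • h - d • hJh
  by_cases h0 : c ^ 2 + d ^ 2 = 0
  · have hc : c = 0 := by nlinarith [sq_nonneg c, sq_nonneg d]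
    have hd : d = 0 := by nlinarith [sq_nonneg c, sq_nonneg d]
    subst hc hd
    exact complexStructure_eq_zero_of_smul_add hJ (by simpa using h) hx
  · exfalso
    refine hy ((c ^ 2 + d ^ 2)⁻¹ * (-(c * a + d * b))) ((c ^ 2 + d ^ 2)⁻¹ * (-(c * b - d * a))) ?_
    have := congrArg (fun z => (c ^ 2 + d ^ 2)⁻¹ • z) hs
    simp only [smul_smul, inv_mul_cancel₀ h0, one_smul] at this
    rw [this]; module

theorem exists_forall_ne_smul_add [FiniteDimensional ℝ V] (hdim : 2 < Module.finrank ℝ V)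
    (x z : V) : ∃ y, ∀ a b : ℝ, y ≠ a • x + b • z := by
  by_contra! hcon
  have htop : Submodule.span ℝ (Set.range ![x, z]) = ⊤ := by
    rw [eq_top_iff]
    rintro y -
    obtain ⟨a, b, rfl⟩ := hcon y
    rw [Matrix.range_cons_cons_empty]
    exact Submodule.mem_span_pair.2 ⟨a, b, rfl⟩
  have h1 := finrank_range_le_card (R := ℝ) ![x, z]
  rw [Set.finrank, htop, finrank_top, Fintype.card_fin] at h1
  omega

/-- Two complex structures with the same complex lines agree up to sign in complex
dimension at least two. -/
theorem complexStructure_eq_or_eq_neg [FiniteDimensional ℝ V] (hdim : 2 < Module.finrank ℝ V)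
    {K : V →ₗ[ℝ] V} (hJ : ∀ x, J (J x) = -x) (hK : ∀ x, K (K x) = -x)
    (h : ∀ x, ∃ a b : ℝ, K x = a • x + b • J x) : (∀ x, K x = J x) ∨ ∀ x, K x = -J x := by
  have : Nontrivial V := Module.nontrivial_of_finrank_pos (R := ℝ) (by omega)
  obtain ⟨x, hx⟩ := exists_ne (0 : V)
  obtain ⟨a, b, hab⟩ := h x
  -- For `y` off the complex line of `x`, comparing `K x + K y` with `K (x + y)` by complex
  -- independence forces the coefficients of `K` at `x` and at `y` to agree.
  have hout : ∀ y, (∀ c d : ℝ, y ≠ c • x + d • J x) → K y = a • y + b • J y := by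
    intro y hy
    obtain ⟨a', b', hab'⟩ := h y
    obtain ⟨a'', b'', hab''⟩ := h (x + y)
    have hy0 : y ≠ 0 := by
      rintro rfl
      exact hy 0 0 (by simp)
    simp only [map_add, hab, hab'] at hab''
    have hrel : (a - a'') • x + (b - b'') • J x + (a' - a'') • y + (b' - b'') • J y = 0 := by
      linear_combination (norm := module) hab''
    obtain ⟨h1, h2⟩ := complexStructure_independent hJ hx hy hrel
    rw [h1, h2] at hrel
    obtain ⟨h3, h4⟩ := complexStructure_eq_zero_of_smul_add hJ
      (c := a' - a'') (d := b' - b'') (x := y) (by simpa using hrel) hy0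
    rw [hab', show a' = a by linarith, show b' = b by linarith]
  have hall : ∀ y, K y = a • y + b • J y := by
    intro y
    by_cases hy : ∀ c d : ℝ, y ≠ c • x + d • J x
    · exact hout y hy
    · push Not at hy
      obtain ⟨c, d, rfl⟩ := hy
      -- A vector on the line of `x` is the difference of two vectors off it, where `hout` applies.
      obtain ⟨z, hz⟩ := exists_forall_ne_smul_add hdim x (J x)
      have hz' : ∀ c' d' : ℝ, (c • x + d • J x) + z ≠ c' • x + d' • J x := by
        intro c' d' he
        refine hz (c' - c) (d' - d) ?_
        linear_combination (norm := module) he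
      have h1 := hout _ hz
      have h2 := hout _ hz'
      rw [map_add K, h1, map_add J (_ + _) z] at h2
      linear_combination (norm := module) h2
  have hsq := hK x
  rw [hall (K x), hall x] at hsq
  -- Read as complex numbers, `K² = -1` says `(a + bi)² = -1`, so `a = 0` and `b = ±1`.
  simp only [map_add, map_smul, hJ] at hsq
  obtain ⟨h1, h2⟩ := complexStructure_eq_zero_of_smul_add hJ
    (c := a ^ 2 - b ^ 2 + 1) (d := 2 * a * b) (x := x)
    (by linear_combination (norm := module) hsq) hx
  have ha : a = 0 := by
    rcases mul_eq_zero.1 h2 with h | h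
    · simpa using h
    · subst h; nlinarith [sq_nonneg a]
  subst ha
  have hb : (b - 1) * (b + 1) = 0 := by linarith
  rcases mul_eq_zero.1 hb with hb | hb
  · left; intro y; rw [hall, show b = 1 by linarith]; simp
  · right; intro y; rw [hall, show b = -1 by linarith]; simp

/-- A linear isomorphism which maps complex lines to complex lines is complex linear or
complex antilinear. -/
theorem map_complexStructure_eq_or_eq_neg [FiniteDimensional ℝ V] {W : Type*} [AddCommGroup W]
    [Module ℝ W] (hdim : 2 < Module.finrank ℝ V) {J' : W →ₗ[ℝ] W} (A : V ≃ₗ[ℝ] W)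
    (hJ : ∀ x, J (J x) = -x) (hJ' : ∀ x, J' (J' x) = -x)
    (h : ∀ α : Submodule ℝ V, Module.finrank ℝ α = 2 → α.map J = α →
      (α.map A.toLinearMap).map J' = α.map A.toLinearMap) :
    (∀ x, A (J x) = J' (A x)) ∨ ∀ x, A (J x) = -J' (A x) := by
  -- Conjugating `J'` back to `V` reduces the claim to two complex structures on one space with the
  -- same complex lines.
  let K : V →ₗ[ℝ] V := A.symm.toLinearMap ∘ₗ J' ∘ₗ A.toLinearMap
  have hKdef : ∀ x, K x = A.symm (J' (A x)) := fun x => rfl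
  have hspan : ∀ x, ∃ a b : ℝ, K x = a • x + b • J x := by
    intro x
    by_cases hx : x = 0
    · exact ⟨0, 0, by simp [hx]⟩
    have hli : LinearIndependent ℝ ![x, J x] := by
      rw [LinearIndependent.pair_iff]
      intro s t hst
      exact complexStructure_eq_zero_of_smul_add hJ hst hx
    have hfin : Module.finrank ℝ (Submodule.span ℝ {x, J x}) = 2 := by
      have := finrank_span_eq_card hli
      rwa [Matrix.range_cons_cons_empty, Fintype.card_fin] at this
    have hmap : (Submodule.span ℝ {x, J x}).map J = Submodule.span ℝ {x, J x} := by
      rw [Submodule.map_span, Set.image_pair, hJ, Set.pair_comm, Submodule.span_insert,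
        Submodule.span_insert x, ← Set.neg_singleton, Submodule.span_neg]
    have hm := h _ hfin hmap
    have hmem : J' (A x) ∈ (Submodule.span ℝ {x, J x}).map A.toLinearMap := by
      rw [← hm]
      exact ⟨A x, ⟨x, Submodule.subset_span (by simp), rfl⟩, rfl⟩
    obtain ⟨y, hy, hyA⟩ := hmem
    obtain ⟨a, b, rfl⟩ := Submodule.mem_span_pair.1 hy
    refine ⟨a, b, ?_⟩
    rw [hKdef, ← hyA]
    exact A.symm_apply_apply _
  rcases complexStructure_eq_or_eq_neg hdim hJ (K := K) (fun x => by simp [hKdef, hJ']) hspan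
    with h1 | h1
  · left; intro x; rw [← h1, hKdef, A.apply_symm_apply]
  · right; intro x
    have : J x = -K x := by rw [h1, neg_neg]
    rw [this, hKdef, map_neg, A.apply_symm_apply]

end ComplexStructure

/-- A one-form whose wedge product with a nondegenerate two-form vanishes is zero in dimension
greater than two. -/
theorem eq_zero_of_wedge_eq_zero {V : Type*} [AddCommGroup V] [Module ℝ V] [FiniteDimensional ℝ V]
    (hdim : 2 < Module.finrank ℝ V) (Ω : V →ₗ[ℝ] V →ₗ[ℝ] ℝ)
    (hnd : ∀ v, (∀ w, Ω v w = 0) → v = 0) (l : V →ₗ[ℝ] ℝ)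
    (h : ∀ u v w, l u * Ω v w + l v * Ω w u + l w * Ω u v = 0) (u : V) : l u = 0 := by
  by_contra hu
  have hrk : Module.finrank ℝ (ℝ × ℝ) < Module.finrank ℝ V := by simpa using hdim
  -- Two linear conditions leave a nonzero `v` in dimension greater than two; for it the wedge
  -- identity collapses to `l u * Ω v w = 0` for every `w`.
  obtain ⟨v, hv, hv0⟩ := Submodule.exists_mem_ne_zero_of_ne_bot
    (LinearMap.ker_ne_bot_of_finrank_lt (f := l.prod (Ω u)) hrk)
  obtain ⟨h1, h2⟩ : l v = 0 ∧ Ω u v = 0 := by simpa using hv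
  refine hv0 (hnd v fun w => ?_)
  have := h u v w
  rw [h1, h2] at this
  simpa [hu] using this

/-! ### Pairs of Hermitian forms -/

section HermitianPair

variable {E : Type*} [NormedAddCommGroup E] [NormedSpace ℝ E] {g g' : E →L[ℝ] E →L[ℝ] ℝ}

theorem quadratic_add_smul (hg : ∀ x y, g x y = g y x) (x y : E) (t : ℝ) :
    g (x + t • y) (x + t • y) = g x x + 2 * t * g x y + t ^ 2 * g y y := by
  simp only [map_add, map_smul, add_apply, smul_apply,
    smul_eq_mul, hg y x]
  ring

/-- A plane on which the form is indefinite contains two isotropic lines. -/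
theorem exists_isotropic_pair (hg : ∀ x y, g x y = g y x) {x y : E} (hx : 0 < g x x)
    (hy : g y y < 0) : ∃ t₁ t₂ : ℝ, t₁ ≠ t₂ ∧ g (x + t₁ • y) (x + t₁ • y) = 0 ∧
      g (x + t₂ • y) (x + t₂ • y) = 0 := by
  have hD : 0 < g x y ^ 2 - g x x * g y y := by
    nlinarith [sq_nonneg (g x y), mul_pos hx (neg_pos.2 hy)]
  set r := √(g x y ^ 2 - g x x * g y y) with hr
  have hr2 : r ^ 2 = g x y ^ 2 - g x x * g y y := Real.sq_sqrt hD.le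
  have hr0 : 0 < r := Real.sqrt_pos.2 hD
  have hy0 : g y y ≠ 0 := hy.ne
  refine ⟨(-g x y + r) / g y y, (-g x y - r) / g y y, ?_, ?_, ?_⟩
  · intro h
    rw [div_left_inj' hy0] at h
    linarith
  · rw [quadratic_add_smul hg]
    field_simp
    linear_combination hr2
  · rw [quadratic_add_smul hg]
    field_simp
    linear_combination hr2

/-- A quadratic form vanishing on the null cone of an indefinite one is proportional to it. -/
theorem exists_eq_mul_of_forall_isotropic (hg : ∀ x y, g x y = g y x)
    (hg' : ∀ x y, g' x y = g' y x) (hpos : ∃ x, 0 < g x x) (hneg : ∃ x, g x x < 0)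
    (h : ∀ x, g x x = 0 → g' x x = 0) : ∃ c, ∀ x y, g' x y = c * g x y := by
  -- On the line `x + t y` both quadratics in `t` have the same two distinct roots, so their
  -- coefficients are proportional.
  have key : ∀ x y, 0 < g x x → g y y < 0 → g' x x * g y y = g' y y * g x x := by
    intro x y hx hy
    obtain ⟨t₁, t₂, hne, h₁, h₂⟩ := exists_isotropic_pair hg hx hy
    have h₁' := h _ h₁
    have h₂' := h _ h₂
    rw [quadratic_add_smul hg] at h₁ h₂
    rw [quadratic_add_smul hg'] at h₁' h₂'
    have hne' : t₁ - t₂ ≠ 0 := sub_ne_zero.2 hne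
    have e₁ : 2 * g x y + (t₁ + t₂) * g y y = 0 :=
      mul_left_cancel₀ hne' (by linear_combination h₁ - h₂)
    have e₂ : 2 * g' x y + (t₁ + t₂) * g' y y = 0 :=
      mul_left_cancel₀ hne' (by linear_combination h₁' - h₂')
    linear_combination g y y * h₁' - g y y * t₁ * e₂ - g' y y * h₁ + g' y y * t₁ * e₁
  obtain ⟨x₀, hx₀⟩ := hpos
  obtain ⟨y₀, hy₀⟩ := hneg
  have hquad : ∀ x, g' x x = g' x₀ x₀ / g x₀ x₀ * g x x := by
    intro x
    have h0 := key x₀ y₀ hx₀ hy₀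
    rcases lt_trichotomy (g x x) 0 with hx | hx | hx
    · have := key x₀ x hx₀ hx
      field_simp
      linear_combination -this
    · rw [h x hx, hx, mul_zero]
    · have := key x y₀ hx hy₀
      have hy0 : g y₀ y₀ ≠ 0 := hy₀.ne
      field_simp
      refine mul_left_cancel₀ hy0 ?_
      linear_combination g x₀ x₀ * this - g x x * h0
  refine ⟨g' x₀ x₀ / g x₀ x₀, fun x y => ?_⟩
  have h1 := quadratic_add_smul hg x y 1
  have h2 := quadratic_add_smul hg' x y 1
  rw [hquad, hquad x, hquad y] at h2
  linear_combination (-1 / 2 : ℝ) * h2 + (1 / 2 : ℝ) * (g' x₀ x₀ / g x₀ x₀) * h1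

variable {J : E →L[ℝ] E}

theorem hermitian_apply_right (hJ : ∀ x, J (J x) = -x) (hgJ : ∀ x y, g (J x) (J y) = g x y)
    (x y : E) : g x (J y) = -g (J x) y := by
  have := hgJ x (J y)
  rw [hJ, map_neg] at this
  exact this.symm

theorem hermitian_self_apply (hg : ∀ x y, g x y = g y x) (hJ : ∀ x, J (J x) = -x)
    (hgJ : ∀ x y, g (J x) (J y) = g x y) (x : E) : g x (J x) = 0 := by
  have := hermitian_apply_right hJ hgJ x x
  rw [hg (J x)] at this
  linarith

/-- If `g'` does not vanish at an isotropic vector `ξ` of `g`, then `ξ` has an isotropic partner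
at which `g'` does not vanish either. -/
theorem exists_isotropic_partner (hg : ∀ x y, g x y = g y x) (hg' : ∀ x y, g' x y = g' y x)
    (hnd : ∀ x, (∀ y, g x y = 0) → x = 0) (hJ : ∀ x, J (J x) = -x)
    (hgJ : ∀ x y, g (J x) (J y) = g x y) (hgJ' : ∀ x y, g' (J x) (J y) = g' x y) {ξ : E}
    (hξ : g ξ ξ = 0) (hξ' : g' ξ ξ ≠ 0) : ∃ η, g η η = 0 ∧ g ξ η ≠ 0 ∧ g' η η ≠ 0 := by
  have hξ0 : ξ ≠ 0 := by
    rintro rfl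
    simp at hξ'
  obtain ⟨z, hz⟩ : ∃ z, g ξ z ≠ 0 := by
    by_contra! hcon
    exact hξ0 (hnd _ hcon)
  -- Normalise `z` against `ξ`, then subtract the multiple of `ξ` that makes the vector isotropic.
  obtain ⟨η, hη, hξη⟩ : ∃ η, g η η = 0 ∧ g ξ η = 1 := by
    refine ⟨(g ξ z)⁻¹ • z + (-((g ξ z)⁻¹ ^ 2 * g z z / 2)) • ξ, ?_, ?_⟩
    · rw [quadratic_add_smul hg]
      simp only [map_smul, smul_apply, smul_eq_mul, hξ, hg z ξ]
      field_simp
      ring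
    · simp [hξ, hz]
  set a := g η (J ξ) with ha
  have hJη : g (J η) ξ = -a := by rw [ha, hermitian_apply_right hJ hgJ]; ring
  -- This correction makes `η₁` orthogonal to `J ξ`, so the whole line `η₁ + t J ξ` consists of
  -- isotropic vectors that pair nontrivially with `ξ`. If `g'` vanished on all of them, its `t²`
  -- coefficient `g'(Jξ, Jξ) = g'(ξ, ξ)` would be zero.
  set η₁ := η + (-a) • J η with hη₁
  have h1 : g η₁ η₁ = 0 := by
    rw [hη₁, quadratic_add_smul hg, hgJ, hη, hermitian_self_apply hg hJ hgJ]; ring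
  have h2 : g ξ η₁ = 1 + a ^ 2 := by
    rw [hη₁, map_add, map_smul, hξη, hg ξ (J η), hJη, smul_eq_mul]; ring
  have h3 : g η₁ (J ξ) = 0 := by
    rw [hη₁]
    simp only [map_add, map_smul, add_apply, smul_apply,
      hgJ, smul_eq_mul, hg η ξ, hξη, ← ha]
    ring
  by_contra! hcon
  have h4 : ∀ t : ℝ, g' η₁ η₁ + 2 * t * g' η₁ (J ξ) + t ^ 2 * g' ξ ξ = 0 := by
    intro t
    rw [← hgJ' ξ ξ, ← quadratic_add_smul hg']
    refine hcon _ ?_ ?_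
    · rw [quadratic_add_smul hg, h1, h3, hgJ, hξ]; ring
    · rw [map_add, map_smul, h2, hermitian_self_apply hg hJ hgJ, smul_zero, add_zero]
      positivity
  apply hξ'
  linear_combination (1 / 2 : ℝ) * h4 1 + (1 / 2 : ℝ) * h4 (-1) - h4 0

end HermitianPair

/-! ### Comparing holomorphic sectional curvatures at a point -/

section Quartic

variable {E : Type*} [NormedAddCommGroup E] [NormedSpace ℝ E] {g g' : E →L[ℝ] E →L[ℝ] ℝ}

/-- A function which restricts to a binary quartic form on every plane. -/
def IsQuartic (P : E → ℝ) : Prop :=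
  ∀ x y, ∃ a₀ a₁ a₂ a₃ a₄ : ℝ, ∀ s t : ℝ, P (s • x + t • y) =
    a₀ * s ^ 4 + a₁ * s ^ 3 * t + a₂ * s ^ 2 * t ^ 2 + a₃ * s * t ^ 3 + a₄ * t ^ 4

/-- This passes identities from points accumulating at `x` to `x` itself. -/
theorem eq_zero_of_frequently_of_continuous {X Y : Type*} [TopologicalSpace X] [TopologicalSpace Y]
    [Zero Y] [T1Space Y] {F : X → Y} {x : X} {l : Filter X} (hl : l ≤ 𝓝 x)
    (hF : ContinuousAt F x) (h : ∃ᶠ y in l, F y = 0) : F x = 0 := by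
  by_contra hne
  exact h (hl (hF.eventually_ne hne))

/-- If the ratio of `P' / g'²` and `P / g²` tends to one at an isotropic vector `ξ` of `g` which is
not isotropic for `g'`, then `P` vanishes to second order at `ξ`. -/
theorem quartic_coeff_eq_zero {P P' : E → ℝ} (hP' : Continuous P') {ξ η : E}
    (hg : ∀ x y, g x y = g y x)
    (hlim : Tendsto (fun x => (P' x / g' x x ^ 2) / (P x / g x x ^ 2))
      (𝓝[{x | g x x ≠ 0 ∧ g' x x ≠ 0 ∧ P x / g x x ^ 2 ≠ 0}] ξ) (𝓝 1))
    (hξ : g ξ ξ = 0) (hη : g η η = 0) (hξη : g ξ η ≠ 0) (hξ' : g' ξ ξ ≠ 0)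
    {a₀ a₁ a₂ a₃ a₄ : ℝ}
    (hP : ∀ t : ℝ, P (ξ + t • η) = a₀ + a₁ * t + a₂ * t ^ 2 + a₃ * t ^ 3 + a₄ * t ^ 4) :
    a₀ = 0 ∧ a₁ = 0 := by
  have hq : ∀ t : ℝ, g (ξ + t • η) (ξ + t • η) = 2 * t * g ξ η := by
    intro t
    rw [quadratic_add_smul hg, hξ, hη]; ring
  have hγ : Continuous fun t : ℝ => ξ + t • η := by fun_prop
  have hself : ∀ᶠ t : ℝ in 𝓝[≠] 0, t ≠ 0 := eventually_mem_nhdsWithin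
  -- Where `P` vanishes the ratio is excluded from the limit. If such points accumulate at `t = 0`,
  -- the polynomial already has the required vanishing coefficients; otherwise the limit may be
  -- taken along the line.
  by_cases hfr : ∃ᶠ t : ℝ in 𝓝[≠] 0, P (ξ + t • η) = 0
  · have h0 : a₀ = 0 := by
      have := eq_zero_of_frequently_of_continuous (x := (0 : ℝ))
        (F := fun t : ℝ => a₀ + a₁ * t + a₂ * t ^ 2 + a₃ * t ^ 3 + a₄ * t ^ 4) nhdsWithin_le_nhds
        (by fun_prop) (hfr.mono fun t ht => by rw [← hP, ht])
      simpa using this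
    refine ⟨h0, ?_⟩
    have := eq_zero_of_frequently_of_continuous (x := (0 : ℝ))
      (F := fun t : ℝ => a₁ + a₂ * t + a₃ * t ^ 2 + a₄ * t ^ 3) nhdsWithin_le_nhds
      (by fun_prop) ((hfr.and_eventually hself).mono fun t ⟨ht, ht0⟩ => by
        refine mul_left_cancel₀ ht0 ?_
        rw [hP, h0] at ht
        linear_combination ht)
    simpa using this
  · rw [not_frequently] at hfr
    have hq'c : Continuous fun t : ℝ => g' (ξ + t • η) (ξ + t • η) := by fun_prop
    have hev' : ∀ᶠ t : ℝ in 𝓝[≠] 0, g' (ξ + t • η) (ξ + t • η) ≠ 0 :=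
      nhdsWithin_le_nhds (hq'c.continuousAt.eventually_ne (by simpa using hξ'))
    have hγlim : Tendsto (fun t : ℝ => ξ + t • η) (𝓝[≠] 0)
        (𝓝[{x | g x x ≠ 0 ∧ g' x x ≠ 0 ∧ P x / g x x ^ 2 ≠ 0}] ξ) := by
      refine tendsto_nhdsWithin_iff.2 ⟨?_, ?_⟩
      · have : Tendsto (fun t : ℝ => ξ + t • η) (𝓝 0) (𝓝 (ξ + (0 : ℝ) • η)) := hγ.tendsto 0
        rw [zero_smul, add_zero] at this
        exact this.mono_left nhdsWithin_le_nhds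
      · filter_upwards [hfr, hev', hself] with t h1 h2 h3
        have h4 : g (ξ + t • η) (ξ + t • η) ≠ 0 := by
          rw [hq]; exact mul_ne_zero (mul_ne_zero two_ne_zero h3) hξη
        exact ⟨h4, h2, div_ne_zero h1 (pow_ne_zero 2 h4)⟩
    have hρ := hlim.comp hγlim
    have hk : Tendsto (fun t : ℝ => 4 * g ξ η ^ 2 * P' (ξ + t • η)
        / g' (ξ + t • η) (ξ + t • η) ^ 2) (𝓝[≠] 0)
        (𝓝 (4 * g ξ η ^ 2 * P' (ξ + (0 : ℝ) • η)
          / g' (ξ + (0 : ℝ) • η) (ξ + (0 : ℝ) • η) ^ 2)) := by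
      have hc : ContinuousAt (fun t : ℝ => 4 * g ξ η ^ 2 * P' (ξ + t • η)
        / g' (ξ + t • η) (ξ + t • η) ^ 2) 0 := by
        refine ContinuousAt.div (by fun_prop) (by fun_prop) ?_
        simpa using hξ'
      exact hc.tendsto.mono_left nhdsWithin_le_nhds
    have hid : Tendsto (fun t : ℝ => t) (𝓝[≠] 0) (𝓝 0) := tendsto_id.mono_left nhdsWithin_le_nhds
    -- Here `H = P / (2 t g(ξ, η))²`, so clearing denominators produces a factor `t²` against a
    -- bounded quantity. Letting `t → 0` gives `a₀ = 0`; dividing by `t` first gives `a₁ = 0`.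
    have hmul : ∀ᶠ t : ℝ in 𝓝[≠] 0,
        ((fun x => (P' x / g' x x ^ 2) / (P x / g x x ^ 2)) ∘ fun t : ℝ => ξ + t • η) t
          * P (ξ + t • η) = t * (t * (4 * g ξ η ^ 2 * P' (ξ + t • η)
        / g' (ξ + t • η) (ξ + t • η) ^ 2)) := by
      filter_upwards [hfr, hev', hself] with t h1 h2 h3
      simp only [Function.comp_apply, hq]
      field_simp
      ring
    have h0 : a₀ = 0 := by
      have hp : Tendsto (fun t : ℝ => P (ξ + t • η)) (𝓝[≠] 0) (𝓝 a₀) := by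
        have : Continuous fun t : ℝ => a₀ + a₁ * t + a₂ * t ^ 2 + a₃ * t ^ 3 + a₄ * t ^ 4 := by
          fun_prop
        simp only [hP]
        simpa using (this.tendsto 0).mono_left (nhdsWithin_le_nhds (s := {0}ᶜ))
      have e1 := (hρ.mul hp).congr' hmul
      have e2 := tendsto_nhds_unique e1 (hid.mul (hid.mul hk))
      simpa using e2
    refine ⟨h0, ?_⟩
    have hp : Tendsto (fun t : ℝ => a₁ + a₂ * t + a₃ * t ^ 2 + a₄ * t ^ 3) (𝓝[≠] 0) (𝓝 a₁) := by
      have : Continuous fun t : ℝ => a₁ + a₂ * t + a₃ * t ^ 2 + a₄ * t ^ 3 := by fun_prop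
      simpa using (this.tendsto 0).mono_left (nhdsWithin_le_nhds (s := {0}ᶜ))
    have hmul' : ∀ᶠ t : ℝ in 𝓝[≠] 0,
        ((fun x => (P' x / g' x x ^ 2) / (P x / g x x ^ 2)) ∘ fun t : ℝ => ξ + t • η) t
          * (a₁ + a₂ * t + a₃ * t ^ 2 + a₄ * t ^ 3) = t * (4 * g ξ η ^ 2 * P' (ξ + t • η)
        / g' (ξ + t • η) (ξ + t • η) ^ 2) := by
      filter_upwards [hmul, hself] with t h1 h2
      refine mul_left_cancel₀ h2 ?_
      rw [← h1, hP, h0]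
      ring
    have e1 := (hρ.mul hp).congr' hmul'
    have e2 := tendsto_nhds_unique e1 (hid.mul hk)
    simpa using e2

/-- If the ratio of `P' / g'²` and `P / g²` tends to one at all isotropic vectors of `g` and
`P / g²` is not constant, then `g'` is proportional to `g`. -/
theorem exists_eq_mul_of_ratio_tendsto_one {P P' : E → ℝ} {J : E →L[ℝ] E}
    (hP : IsQuartic P) (hPc : Continuous P) (hP' : Continuous P')
    (hg : ∀ x y, g x y = g y x) (hg' : ∀ x y, g' x y = g' y x)
    (hnd : ∀ x, (∀ y, g x y = 0) → x = 0) (hpos : ∃ x, 0 < g x x) (hneg : ∃ x, g x x < 0)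
    (hJ : ∀ x, J (J x) = -x) (hgJ : ∀ x y, g (J x) (J y) = g x y)
    (hgJ' : ∀ x y, g' (J x) (J y) = g' x y)
    (hlim : ∀ ξ, g ξ ξ = 0 → ξ ≠ 0 → Tendsto (fun x => (P' x / g' x x ^ 2) / (P x / g x x ^ 2))
      (𝓝[{x | g x x ≠ 0 ∧ g' x x ≠ 0 ∧ P x / g x x ^ 2 ≠ 0}] ξ) (𝓝 1))
    (hnc : ¬ ∃ c, ∀ x, g x x ≠ 0 → P x / g x x ^ 2 = c) : ∃ c, ∀ x y, g' x y = c * g x y := by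
  refine exists_eq_mul_of_forall_isotropic hg hg' hpos hneg ?_
  by_contra! hcon
  obtain ⟨ξ, hξ, hξ'⟩ := hcon
  obtain ⟨η, hη, hξη, hη'⟩ := exists_isotropic_partner hg hg' hnd hJ hgJ hgJ' hξ hξ'
  -- `P / g²` is constant on the planes spanned by isotropic vectors that are not isotropic for `g'`
  have hplane : ∀ u v, g u u = 0 → g v v = 0 → g u v ≠ 0 → g' u u ≠ 0 → g' v v ≠ 0 →
      ∃ k, ∀ s t : ℝ, P (s • u + t • v) = k * g (s • u + t • v) (s • u + t • v) ^ 2 := by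
    intro u v hu hv huv hu' hv'
    obtain ⟨a₀, a₁, a₂, a₃, a₄, ha⟩ := hP u v
    have hu0 : u ≠ 0 := by rintro rfl; simp at hu'
    have hv0 : v ≠ 0 := by rintro rfl; simp at hv'
    obtain ⟨h0, h1⟩ := quartic_coeff_eq_zero (a₀ := a₀) (a₁ := a₁) (a₂ := a₂) (a₃ := a₃) (a₄ := a₄)
      hP' hg (hlim u hu hu0) hu hv huv hu' (fun t => by
        have := ha 1 t
        rw [one_smul] at this
        rw [this]; ring)
    -- Exchanging `u` and `v` reverses the coefficients. Only `a₂ s² t²` survives, and it is a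
    -- multiple of `g² = (2 s t g(u, v))²`.
    obtain ⟨h4, h3⟩ := quartic_coeff_eq_zero (a₀ := a₄) (a₁ := a₃) (a₂ := a₂) (a₃ := a₁) (a₄ := a₀)
      hP' hg (hlim v hv hv0) hv hu (by rwa [hg]) hv' (fun t => by
        have := ha t 1
        rw [one_smul, add_comm] at this
        rw [this]; ring)
    refine ⟨a₂ / (2 * g u v) ^ 2, fun s t => ?_⟩
    have hq : g (s • u + t • v) (s • u + t • v) = s * t * (2 * g u v) := by
      rw [quadratic_add_smul hg]
      simp only [map_smul, smul_apply, smul_eq_mul, hu, hv]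
      ring
    rw [ha, hq, h0, h1, h3, h4]
    field_simp
    ring
  -- the resultant of the restrictions of the quadratic forms to the plane of `x, y`
  let res : E → E → ℝ := fun x y => (g x x * g' y y - g y y * g' x x) ^ 2
    - 4 * (g x x * g' x y - g x y * g' x x) * (g x y * g' y y - g y y * g' x y)
  have hgeneric : ∀ x y, 0 < g x x → g y y < 0 → res x y ≠ 0 →
      P x * g y y ^ 2 - P y * g x x ^ 2 = 0 := by
    intro x y hx hy hres
    obtain ⟨t₁, t₂, hne, h₁, h₂⟩ := exists_isotropic_pair hg hx hy
    -- A common root of the two quadratics would make their resultant vanish.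
    have hroot : ∀ t : ℝ, g (x + t • y) (x + t • y) = 0 → g' (x + t • y) (x + t • y) ≠ 0 := by
      intro t ht ht'
      rw [quadratic_add_smul hg] at ht
      rw [quadratic_add_smul hg'] at ht'
      apply hres
      have e : g x x = -2 * t * g x y - t ^ 2 * g y y := by linear_combination ht
      have e' : g' x x = -2 * t * g' x y - t ^ 2 * g' y y := by linear_combination ht'
      simp only [res, e, e']
      ring
    have hne' : t₂ - t₁ ≠ 0 := sub_ne_zero.2 hne.symm
    have hxe : x = (t₂ / (t₂ - t₁)) • (x + t₁ • y) + (-t₁ / (t₂ - t₁)) • (x + t₂ • y) := by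
      match_scalars <;> field_simp <;> ring
    have hye : y = (-1 / (t₂ - t₁)) • (x + t₁ • y) + (1 / (t₂ - t₁)) • (x + t₂ • y) := by
      match_scalars <;> field_simp <;> ring
    have hgne : g (x + t₁ • y) (x + t₂ • y) ≠ 0 := by
      intro h0
      have : g y y = 0 := by
        have e := congrArg (fun z => g z z) hye
        refine e.trans ?_
        rw [ quadratic_add_smul hg]
        simp only [map_smul, smul_apply, smul_eq_mul, h₁, h₂, h0]
        ring
      exact hy.ne this
    obtain ⟨k, hk⟩ := hplane _ _ h₁ h₂ hgne (hroot _ h₁) (hroot _ h₂)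
    have hkx := hk (t₂ / (t₂ - t₁)) (-t₁ / (t₂ - t₁))
    have hky := hk (-1 / (t₂ - t₁)) (1 / (t₂ - t₁))
    rw [← hxe] at hkx
    rw [← hye] at hky
    rw [hkx, hky]
    ring
  have hall : ∀ x y, 0 < g x x → g y y < 0 → P x * g y y ^ 2 - P y * g x x ^ 2 = 0 := by
    intro x y hx hy
    -- Move along segments from `(x, y)` to `(ξ + η, ξ - η)`, where the resultant is `64 g(ξ, η)²
    -- g'(ξ, ξ) g'(η, η) ≠ 0`. It is analytic in `t`, so it is nonzero for small `t ≠ 0`; the signs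
    -- of `g` persist there too, and continuity carries the generic identity back to `t = 0`.
    let X : ℝ → E := fun t => x + t • (ξ + η - x)
    let Y : ℝ → E := fun t => y + t • (ξ - η - y)
    have hXc : Continuous X := by fun_prop
    have hYc : Continuous Y := by fun_prop
    have hX0 : X 0 = x := by simp [X]
    have hY0 : Y 0 = y := by simp [Y]
    have hX1 : X 1 = ξ + η := by simp [X]
    have hY1 : Y 1 = ξ - η := by simp [Y]
    have hXa : AnalyticOnNhd ℝ X Set.univ := by intro t _; fun_prop
    have hYa : AnalyticOnNhd ℝ Y Set.univ := by intro t _; fun_prop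
    have hbil : ∀ (b : E →L[ℝ] E →L[ℝ] ℝ) {F G : ℝ → E}, AnalyticOnNhd ℝ F Set.univ →
        AnalyticOnNhd ℝ G Set.univ → AnalyticOnNhd ℝ (fun t => b (F t) (G t)) Set.univ := by
      intro b F G hF hG t ht
      have h1 := (b.analyticAt_bilinear (F t, G t)).comp₂ (hF t ht) (hG t ht)
      exact h1
    have hra : AnalyticOnNhd ℝ (fun t => res (X t) (Y t)) Set.univ := by
      simp only [res]
      have h1 := hbil g hXa hXa
      have h2 := hbil g hXa hYa
      have h3 := hbil g hYa hYa
      have h1' := hbil g' hXa hXa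
      have h2' := hbil g' hXa hYa
      have h3' := hbil g' hYa hYa
      exact (((h1.mul h3').sub (h3.mul h1')).pow 2).sub
        (((analyticOnNhd_const.mul ((h1.mul h2').sub (h2.mul h1'))).mul
          ((h2.mul h3').sub (h3.mul h2'))))
    have hres1 : res (X 1) (Y 1) ≠ 0 := by
      have e : res (X 1) (Y 1) = 64 * (g ξ η) ^ 2 * g' ξ ξ * g' η η := by
        simp only [res, hX1, hY1]
        simp only [map_add, map_sub, add_apply,
          sub_apply, hg η ξ, hg' η ξ, hξ, hη]
        ring
      rw [e]
      positivity
    have hev : ∀ᶠ t : ℝ in 𝓝[≠] 0, res (X t) (Y t) ≠ 0 := by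
      by_contra hfr
      simp only [not_eventually, not_not] at hfr
      exact hres1 (hra.eqOn_zero_of_preconnected_of_frequently_eq_zero isPreconnected_univ
        (Set.mem_univ 0) hfr (Set.mem_univ 1))
    have hev1 : ∀ᶠ t : ℝ in 𝓝 0, 0 < g (X t) (X t) :=
      (show Continuous fun t => g (X t) (X t) by fun_prop).continuousAt.eventually_const_lt
        (by simpa only [hX0])
    have hev2 : ∀ᶠ t : ℝ in 𝓝 0, g (Y t) (Y t) < 0 :=
      (show Continuous fun t => g (Y t) (Y t) by fun_prop).continuousAt.eventually_lt_const
        (by simpa only [hY0])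
    have hfin := eq_zero_of_frequently_of_continuous (x := (0 : ℝ)) (l := 𝓝[≠] 0)
      (F := fun t => P (X t) * g (Y t) (Y t) ^ 2 - P (Y t) * g (X t) (X t) ^ 2) nhdsWithin_le_nhds
      (by fun_prop) (Eventually.frequently (by
        filter_upwards [hev, nhdsWithin_le_nhds hev1, nhdsWithin_le_nhds hev2] with t h1 h2 h3
        exact hgeneric _ _ h2 h3 h1))
    simpa only [hX0, hY0] using hfin
  obtain ⟨x₀, hx₀⟩ := hpos
  obtain ⟨y₀, hy₀⟩ := hneg
  refine hnc ⟨P x₀ / g x₀ x₀ ^ 2, fun x hx => ?_⟩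
  have hy0 := hy₀.ne
  have e0 := hall x₀ y₀ hx₀ hy₀
  rcases lt_or_gt_of_ne hx with hx' | hx'
  · have := hall x₀ x hx₀ hx'
    field_simp
    linear_combination -this
  · have := hall x y₀ hx' hy₀
    field_simp
    refine mul_left_cancel₀ (pow_ne_zero 2 hy0) ?_
    linear_combination g x₀ x₀ ^ 2 * this - g x x ^ 2 * e0

end Quartic

/-! ### Local metrics and their Levi-Civita connection -/

namespace LocalMetric

variable {E : Type*} [NormedAddCommGroup E] [NormedSpace ℝ E]

/-- Near `y`, `G` is a symmetric, nondegenerate and three times continuously differentiable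
metric. -/
structure IsRegularAt (G : E → E →L[ℝ] E →L[ℝ] ℝ) (y : E) : Prop where
  contDiffAt : ContDiffAt ℝ 3 G y
  symm : ∀ᶠ z in 𝓝 y, ∀ v w, G z v w = G z w v
  isInvertible : ∀ᶠ z in 𝓝 y, (G z).IsInvertible

/-- The Christoffel symbols as a continuous bilinear map. -/
def christoffelL (G : E → E →L[ℝ] E →L[ℝ] ℝ) (y : E) : E →L[ℝ] E →L[ℝ] E :=
  (ContinuousLinearMap.compL ℝ E (E →L[ℝ] ℝ) E (G y).inverse).comp ((1 / 2 : ℝ) •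
    (fderiv ℝ G y + (fderiv ℝ G y).flip -
      (ContinuousLinearMap.flipₗᵢ ℝ E E ℝ : (E →L[ℝ] E →L[ℝ] ℝ) →L[ℝ] (E →L[ℝ] E →L[ℝ] ℝ)).comp
        (fderiv ℝ G y).flip))

variable {G : E → E →L[ℝ] E →L[ℝ] ℝ} {y : E}

theorem christoffelL_apply (G : E → E →L[ℝ] E →L[ℝ] ℝ) (y v w : E) :
    christoffelL G y v w = christoffel G y v w := by
  rfl

namespace IsRegularAt

theorem eventually (h : IsRegularAt G y) : ∀ᶠ z in 𝓝 y, IsRegularAt G z := by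
  filter_upwards [h.contDiffAt.eventually (by simp), h.symm.eventually_nhds,
    h.isInvertible.eventually_nhds] with z h1 h2 h3
  exact ⟨h1, h2, h3⟩

theorem differentiableAt (h : IsRegularAt G y) : DifferentiableAt ℝ G y :=
  h.contDiffAt.differentiableAt (by simp)

theorem eq_of_apply_eq (h : IsRegularAt G y) {v w : E} (hvw : ∀ u, G y v u = G y w u) : v = w :=
  h.isInvertible.self_of_nhds.injective (ContinuousLinearMap.ext hvw)

theorem apply_christoffel (h : IsRegularAt G y) (v w u : E) :
    G y (christoffelL G y v w) u = (1 / 2 : ℝ) *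
      (fderiv ℝ G y v w u + fderiv ℝ G y w v u - fderiv ℝ G y u v w) := by
  rw [christoffelL_apply, christoffel, h.isInvertible.self_of_nhds.self_apply_inverse]
  simp

theorem fderiv_symm (h : IsRegularAt G y) (u v w : E) :
    fderiv ℝ G y u v w = fderiv ℝ G y u w v := by
  have h1 : ∀ v w, HasFDerivAt (fun z => G z v w)
      ((ContinuousLinearMap.apply ℝ ℝ w).comp
        ((ContinuousLinearMap.apply ℝ (E →L[ℝ] ℝ) v).comp (fderiv ℝ G y))) y := by
    intro v w
    have := h.differentiableAt.hasFDerivAt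
    exact (ContinuousLinearMap.apply ℝ ℝ w).hasFDerivAt.comp y
      ((ContinuousLinearMap.apply ℝ (E →L[ℝ] ℝ) v).hasFDerivAt.comp y this)
  have h2 := (h1 v w).unique ((h1 w v).congr_of_eventuallyEq
    (h.symm.mono fun z hz => hz v w))
  simpa using DFunLike.congr_fun h2 u

theorem christoffel_symm (h : IsRegularAt G y) (v w : E) :
    christoffelL G y v w = christoffelL G y w v := by
  refine h.eq_of_apply_eq fun u => ?_
  rw [h.apply_christoffel, h.apply_christoffel, h.fderiv_symm u v w]
  ring

/-- Metric compatibility of the Levi-Civita connection: in the sum of two Koszul formulas all but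
one derivative cancel. -/
theorem fderiv_apply (h : IsRegularAt G y) (u v w : E) :
    fderiv ℝ G y u v w = G y (christoffelL G y u v) w + G y (christoffelL G y u w) v := by
  rw [h.apply_christoffel, h.apply_christoffel, h.fderiv_symm v u w, h.fderiv_symm u w v,
    h.fderiv_symm w u v]
  ring

theorem differentiableAt_christoffelL [CompleteSpace E] (h : IsRegularAt G y) :
    DifferentiableAt ℝ (christoffelL G) y := by
  have h1 : ContDiffAt ℝ 1 (fderiv ℝ G) y := h.contDiffAt.fderiv_right (by norm_num)
  have h2 : DifferentiableAt ℝ (fderiv ℝ G) y := h1.differentiableAt (by simp)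
  have h3 : DifferentiableAt ℝ (fun z => (G z).inverse) y :=
    (h.isInvertible.self_of_nhds.contDiffAt_map_inverse (n := 1)).differentiableAt (by simp)
      |>.comp y h.differentiableAt
  have h4 : DifferentiableAt ℝ (fun z => (fderiv ℝ G z).flip) y :=
    (ContinuousLinearMap.flipₗᵢ ℝ E E (E →L[ℝ] ℝ)).toContinuousLinearEquiv.differentiableAt.comp
      y h2
  unfold christoffelL
  have h5 : DifferentiableAt ℝ
      (fun z => ContinuousLinearMap.compL ℝ E (E →L[ℝ] ℝ) E (G z).inverse) y :=
    (ContinuousLinearMap.compL ℝ E (E →L[ℝ] ℝ) E).differentiableAt.comp y h3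
  have h6 : DifferentiableAt ℝ (fun z =>
      (ContinuousLinearMap.flipₗᵢ ℝ E E ℝ : (E →L[ℝ] E →L[ℝ] ℝ) →L[ℝ] (E →L[ℝ] E →L[ℝ] ℝ)).comp
        (fderiv ℝ G z).flip) y := (differentiableAt_const _).clm_comp h4
  exact h5.clm_comp (((h2.add h4).sub h6).const_smul (1 / 2 : ℝ))

/-- Differentiating the Christoffel symbols as one bilinear-map-valued function makes linearity in
each argument visible. -/
theorem curvatureOperator_eq [CompleteSpace E] (h : IsRegularAt G y) (u v w : E) :
    curvatureOperator G y u v w = fderiv ℝ (christoffelL G) y u v w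
      - fderiv ℝ (christoffelL G) y v u w + christoffelL G y u (christoffelL G y v w)
      - christoffelL G y v (christoffelL G y u w) := by
  have key : ∀ v w u, fderiv ℝ (fun z => christoffel G z v w) y u
      = fderiv ℝ (christoffelL G) y u v w := by
    intro v w u
    have h1 : HasFDerivAt (fun z => christoffelL G z v w)
        ((ContinuousLinearMap.apply ℝ E w).comp
          ((ContinuousLinearMap.apply ℝ (E →L[ℝ] E) v).comp (fderiv ℝ (christoffelL G) y))) y :=
      (ContinuousLinearMap.apply ℝ E w).hasFDerivAt.comp y
        ((ContinuousLinearMap.apply ℝ (E →L[ℝ] E) v).hasFDerivAt.comp y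
          h.differentiableAt_christoffelL.hasFDerivAt)
    simp only [← christoffelL_apply]
    rw [h1.fderiv]
    rfl
  simp only [curvatureOperator, key, christoffelL_apply]

end IsRegularAt

/-! ### Local homotheties -/

section Homothety

variable {G' : E → E →L[ℝ] E →L[ℝ] ℝ} {F : E → E} {c : ℝ}

theorem hasFDerivAt_apply_const {X Y : Type*} [NormedAddCommGroup X] [NormedSpace ℝ X]
    [NormedAddCommGroup Y] [NormedSpace ℝ Y] {K : E → X →L[ℝ] Y} {K' : E →L[ℝ] X →L[ℝ] Y}
    (hK : HasFDerivAt K K' y) (x : X) :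
    HasFDerivAt (fun z => K z x) ((ContinuousLinearMap.apply ℝ Y x).comp K') y :=
  (ContinuousLinearMap.apply ℝ Y x).hasFDerivAt.comp y hK

/-- Derivative of a pulled back bilinear form. -/
theorem hasFDerivAt_pullback {B : E → E →L[ℝ] E →L[ℝ] ℝ} (hB : DifferentiableAt ℝ B (F y))
    (hF : DifferentiableAt ℝ F y) (hF' : DifferentiableAt ℝ (fderiv ℝ F) y) (v w : E) :
    ∃ D : E →L[ℝ] ℝ, HasFDerivAt (fun z => B (F z) (fderiv ℝ F z v) (fderiv ℝ F z w)) D y ∧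
      ∀ u, D u = fderiv ℝ B (F y) (fderiv ℝ F y u) (fderiv ℝ F y v) (fderiv ℝ F y w)
        + B (F y) (fderiv ℝ (fderiv ℝ F) y u v) (fderiv ℝ F y w)
        + B (F y) (fderiv ℝ F y v) (fderiv ℝ (fderiv ℝ F) y u w) := by
  have h1 : ∀ v, HasFDerivAt (fun z => fderiv ℝ F z v)
      ((ContinuousLinearMap.apply ℝ E v).comp (fderiv ℝ (fderiv ℝ F) y)) y := fun v =>
    (ContinuousLinearMap.apply ℝ E v).hasFDerivAt.comp y hF'.hasFDerivAt
  have h2 := ((hB.hasFDerivAt.comp y hF.hasFDerivAt).clm_apply (h1 v)).clm_apply (h1 w)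
  refine ⟨_, h2, fun u => ?_⟩
  simp
  ring

/-- Differentiate the pullback identity and take the Koszul combination of its three permutations.
The constant factor passes through, and symmetry of the second derivative of `F` cancels all
second-order terms but one: the usual inhomogeneous term. -/
theorem fderiv_apply_christoffelL (hG : IsRegularAt G y) (hG' : IsRegularAt G' (F y))
    (hF : ContDiffAt ℝ 3 F y) (hsurj : Function.Surjective (fderiv ℝ F y))
    (hpull : ∀ᶠ z in 𝓝 y, ∀ v w, G' (F z) (fderiv ℝ F z v) (fderiv ℝ F z w) = c * G z v w)
    (v w : E) : fderiv ℝ F y (christoffelL G y v w) =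
      christoffelL G' (F y) (fderiv ℝ F y v) (fderiv ℝ F y w)
        + fderiv ℝ (fderiv ℝ F) y v w := by
  have hF1 : DifferentiableAt ℝ F y := hF.differentiableAt (by simp)
  have hF2 : DifferentiableAt ℝ (fderiv ℝ F) y :=
    (hF.fderiv_right (m := 1) (by norm_num)).differentiableAt (by simp)
  have hsymm : IsSymmSndFDerivAt ℝ F y := hF.isSymmSndFDerivAt (by simp; norm_num)
  have hD : ∀ u v w, c * fderiv ℝ G y u v w =
      fderiv ℝ G' (F y) (fderiv ℝ F y u) (fderiv ℝ F y v) (fderiv ℝ F y w)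
        + G' (F y) (fderiv ℝ (fderiv ℝ F) y u v) (fderiv ℝ F y w)
        + G' (F y) (fderiv ℝ F y v) (fderiv ℝ (fderiv ℝ F) y u w) := by
    intro u v w
    obtain ⟨D, hD, hDu⟩ := hasFDerivAt_pullback hG'.differentiableAt hF1 hF2 v w
    have h1 : HasFDerivAt (fun z => c * G z v w) (c • ((ContinuousLinearMap.apply ℝ ℝ w).comp
        ((ContinuousLinearMap.apply ℝ (E →L[ℝ] ℝ) v).comp (fderiv ℝ G y)))) y :=
      ((ContinuousLinearMap.apply ℝ ℝ w).hasFDerivAt.comp y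
        ((ContinuousLinearMap.apply ℝ (E →L[ℝ] ℝ) v).hasFDerivAt.comp y
          hG.differentiableAt.hasFDerivAt)).const_mul c
    have h2 := h1.unique (hD.congr_of_eventuallyEq (hpull.mono fun z hz => (hz v w).symm))
    rw [← hDu, ← h2]
    simp
  refine hG'.eq_of_apply_eq fun u' => ?_
  obtain ⟨u, rfl⟩ := hsurj u'
  have hs := hG'.symm.self_of_nhds
  rw [hpull.self_of_nhds, hG.apply_christoffel, map_add, add_apply, hG'.apply_christoffel]
  have e1 := hD v w u
  have e2 := hD w v u
  have e3 := hD u v w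
  rw [hsymm w v, hs _ (fderiv ℝ (fderiv ℝ F) y w u)] at e2
  rw [hsymm u v, hsymm u w, hs _ (fderiv ℝ (fderiv ℝ F) y w u)] at e3
  rw [hs (fderiv ℝ F y w)] at e1
  linear_combination (1 / 2 : ℝ) * e1 + (1 / 2 : ℝ) * e2 - (1 / 2 : ℝ) * e3

/-- The curvature operator is preserved by local homotheties. -/
theorem fderiv_apply_curvatureOperator [CompleteSpace E] (hG : IsRegularAt G y)
    (hG' : IsRegularAt G' (F y)) (hF : ContDiffAt ℝ 3 F y)
    (hsurj : ∀ᶠ z in 𝓝 y, Function.Surjective (fderiv ℝ F z))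
    (hpull : ∀ᶠ z in 𝓝 y, ∀ v w, G' (F z) (fderiv ℝ F z v) (fderiv ℝ F z w) = c * G z v w)
    (u v w : E) : fderiv ℝ F y (curvatureOperator G y u v w) =
      curvatureOperator G' (F y) (fderiv ℝ F y u) (fderiv ℝ F y v) (fderiv ℝ F y w) := by
  have hF1 : DifferentiableAt ℝ F y := hF.differentiableAt (by simp)
  have hA : ContDiffAt ℝ 2 (fderiv ℝ F) y := hF.fderiv_right (by norm_num)
  have hA1 : DifferentiableAt ℝ (fderiv ℝ F) y := hA.differentiableAt (by simp)
  have hA2 : DifferentiableAt ℝ (fderiv ℝ (fderiv ℝ F)) y :=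
    (hA.fderiv_right (m := 1) (by norm_num)).differentiableAt (by simp)
  have hsymm : IsSymmSndFDerivAt ℝ F y := hF.isSymmSndFDerivAt (by simp; norm_num)
  have hsymm' : IsSymmSndFDerivAt ℝ (fderiv ℝ F) y := hA.isSymmSndFDerivAt (by simp)
  have hnat : ∀ᶠ z in 𝓝 y, ∀ v w, fderiv ℝ F z (christoffelL G z v w) =
      christoffelL G' (F z) (fderiv ℝ F z v) (fderiv ℝ F z w) + fderiv ℝ (fderiv ℝ F) z v w := by
    filter_upwards [hG.eventually, hF1.continuousAt.eventually hG'.eventually,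
      hF.eventually (by simp), hsurj, hpull.eventually_nhds] with z h1 h2 h3 h4 h5
    exact fderiv_apply_christoffelL h1 h2 h3 h4 h5
  have hΓ := hG.differentiableAt_christoffelL.hasFDerivAt
  have hΓ' := hG'.differentiableAt_christoffelL.hasFDerivAt
  -- The transformation law holds near `y`, so it can be differentiated once more. Antisymmetrising
  -- in `u` and `v` then removes the third derivative of `F`.
  have hD : ∀ u v w, fderiv ℝ F y (fderiv ℝ (christoffelL G) y u v w)
      + fderiv ℝ (fderiv ℝ F) y u (christoffelL G y v w) =
      fderiv ℝ (christoffelL G') (F y) (fderiv ℝ F y u) (fderiv ℝ F y v) (fderiv ℝ F y w)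
      + christoffelL G' (F y) (fderiv ℝ (fderiv ℝ F) y u v) (fderiv ℝ F y w)
      + christoffelL G' (F y) (fderiv ℝ F y v) (fderiv ℝ (fderiv ℝ F) y u w)
      + fderiv ℝ (fderiv ℝ (fderiv ℝ F)) y u v w := by
    intro u v w
    have hl := hA1.hasFDerivAt.clm_apply (hasFDerivAt_apply_const (hasFDerivAt_apply_const hΓ v) w)
    have hr := (((hΓ'.comp y hF1.hasFDerivAt).clm_apply
      (hasFDerivAt_apply_const hA1.hasFDerivAt v)).clm_apply
      (hasFDerivAt_apply_const hA1.hasFDerivAt w)).add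
      (hasFDerivAt_apply_const (hasFDerivAt_apply_const hA2.hasFDerivAt v) w)
    have := DFunLike.congr_fun
      (hl.unique (hr.congr_of_eventuallyEq (hnat.mono fun z hz => hz v w))) u
    simp at this
    rw [this]
    abel
  have hn := hnat.self_of_nhds
  have e1 := hD u v w
  have e2 := hD v u w
  rw [hsymm' v u, hsymm v u] at e2
  rw [hG.curvatureOperator_eq, hG'.curvatureOperator_eq]
  simp only [map_sub, map_add, hn]
  linear_combination (norm := module) e1 - e2

end Homothety

/-! ### The fundamental form -/

section FundamentalForm

variable {J : E → E →L[ℝ] E}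

/-- The fundamental two-form `(v, w) ↦ G(J v, w)`. -/
def fundamentalForm (G : E → E →L[ℝ] E →L[ℝ] ℝ) (J : E → E →L[ℝ] E) (y : E) :
    E →L[ℝ] E →L[ℝ] ℝ :=
  (G y).comp (J y)

theorem differentiableAt_fundamentalForm (hG : DifferentiableAt ℝ G y)
    (hJ : DifferentiableAt ℝ J y) : DifferentiableAt ℝ (fundamentalForm G J) y :=
  hG.clm_comp hJ

/-- The fundamental form of a Kähler structure is closed. -/
theorem fundamentalForm_closed (hG : IsRegularAt G y) (hJ : DifferentiableAt ℝ J y)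
    (hskew : ∀ v w, G y (J y v) w = -G y v (J y w))
    (hpar : ∀ v w, covDerivEnd G J y v w = 0) (u v w : E) :
    fderiv ℝ (fundamentalForm G J) y u v w + fderiv ℝ (fundamentalForm G J) y v w u
      + fderiv ℝ (fundamentalForm G J) y w u v = 0 := by
  have hs := hG.symm.self_of_nhds
  -- Metric compatibility and `∇J = 0` express the derivative of the form by Christoffel symbols
  -- alone; their symmetry cancels the cyclic sum.
  have hD : ∀ u v w, fderiv ℝ (fundamentalForm G J) y u v w =
      G y (J y v) (christoffelL G y u w) - G y (J y w) (christoffelL G y u v) := by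
    intro u v w
    have h1 : HasFDerivAt (fundamentalForm G J) _ y :=
      hG.differentiableAt.hasFDerivAt.clm_comp hJ.hasFDerivAt
    have h2 := hpar u v
    rw [covDerivEnd, ← christoffelL_apply, ← christoffelL_apply, add_sub_assoc] at h2
    have h3 := eq_neg_of_add_eq_zero_left h2
    rw [h1.fderiv]
    simp only [add_apply, ContinuousLinearMap.comp_apply, ContinuousLinearMap.compL_apply,
      ContinuousLinearMap.flip_apply]
    rw [hG.fderiv_apply, h3]
    simp only [map_neg, map_sub, neg_apply, sub_apply, hskew (christoffelL G y u v) w]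
    rw [hs (christoffelL G y u w), hs (J y w)]
    ring
  rw [hD u v w, hD v w u, hD w u v, hG.christoffel_symm v u, hG.christoffel_symm w u,
    hG.christoffel_symm w v]
  ring

/-- If the fundamental forms of two Kähler structures are conformal then the differential of the
conformal factor vanishes. -/
theorem wedge_fundamentalForm_eq_zero {G' : E → E →L[ℝ] E →L[ℝ] ℝ} {J' : E → E →L[ℝ] E} {F : E → E}
    {c : E → ℝ} (hG : IsRegularAt G y) (hG' : IsRegularAt G' (F y)) (hJ : DifferentiableAt ℝ J y)
    (hJ' : DifferentiableAt ℝ J' (F y)) (hF : ContDiffAt ℝ 3 F y) (hc : DifferentiableAt ℝ c y)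
    (hskew : ∀ v w, G y (J y v) w = -G y v (J y w))
    (hskew' : ∀ v w, G' (F y) (J' (F y) v) w = -G' (F y) v (J' (F y) w))
    (hpar : ∀ v w, covDerivEnd G J y v w = 0) (hpar' : ∀ v w, covDerivEnd G' J' (F y) v w = 0)
    (hpull : ∀ᶠ z in 𝓝 y, ∀ v w, fundamentalForm G' J' (F z) (fderiv ℝ F z v) (fderiv ℝ F z w) =
      c z * fundamentalForm G J z v w) (u v w : E) :
    fderiv ℝ c y u * fundamentalForm G J y v w + fderiv ℝ c y v * fundamentalForm G J y w u
      + fderiv ℝ c y w * fundamentalForm G J y u v = 0 := by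
  have hF1 : DifferentiableAt ℝ F y := hF.differentiableAt (by simp)
  have hF2 : DifferentiableAt ℝ (fderiv ℝ F) y :=
    (hF.fderiv_right (m := 1) (by norm_num)).differentiableAt (by simp)
  have hsymm : IsSymmSndFDerivAt ℝ F y := hF.isSymmSndFDerivAt (by simp; norm_num)
  have hΩ := differentiableAt_fundamentalForm hG.differentiableAt hJ
  have hΩ' := differentiableAt_fundamentalForm hG'.differentiableAt hJ'
  have hanti : ∀ v w, fundamentalForm G' J' (F y) v w = -fundamentalForm G' J' (F y) w v := by
    intro v w
    change G' (F y) (J' (F y) v) w = -G' (F y) (J' (F y) w) v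
    rw [hskew', hG'.symm.self_of_nhds]
  -- In the cyclic sum of this product rule the second derivatives of `F` cancel, by their symmetry
  -- and the antisymmetry of the form; closedness of both forms leaves only the terms in `dc`.
  have hD : ∀ u v w, fderiv ℝ c y u * fundamentalForm G J y v w
      + c y * fderiv ℝ (fundamentalForm G J) y u v w =
      fderiv ℝ (fundamentalForm G' J') (F y) (fderiv ℝ F y u) (fderiv ℝ F y v) (fderiv ℝ F y w)
        + fundamentalForm G' J' (F y) (fderiv ℝ (fderiv ℝ F) y u v) (fderiv ℝ F y w)
        + fundamentalForm G' J' (F y) (fderiv ℝ F y v) (fderiv ℝ (fderiv ℝ F) y u w) := by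
    intro u v w
    obtain ⟨D, hD, hDu⟩ := hasFDerivAt_pullback hΩ' hF1 hF2 v w
    have h1 : HasFDerivAt (fun z => fundamentalForm G J z v w)
        ((ContinuousLinearMap.apply ℝ ℝ w).comp
        ((ContinuousLinearMap.apply ℝ (E →L[ℝ] ℝ) v).comp (fderiv ℝ (fundamentalForm G J) y))) y :=
      (ContinuousLinearMap.apply ℝ ℝ w).hasFDerivAt.comp y
        ((ContinuousLinearMap.apply ℝ (E →L[ℝ] ℝ) v).hasFDerivAt.comp y hΩ.hasFDerivAt)
    have h2 := (hc.hasFDerivAt.mul h1).unique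
      (hD.congr_of_eventuallyEq (hpull.mono fun z hz => (hz v w).symm))
    rw [← hDu, ← h2]
    simp
    ring
  have e1 := hD u v w
  have e2 := hD v w u
  have e3 := hD w u v
  rw [hsymm v u, hanti _ (fderiv ℝ (fderiv ℝ F) y u v)] at e2
  rw [hsymm w u, hsymm w v, hanti _ (fderiv ℝ (fderiv ℝ F) y v w)] at e3
  rw [hanti _ (fderiv ℝ (fderiv ℝ F) y u w)] at e1
  have hcl := fundamentalForm_closed hG hJ hskew hpar u v w
  have hcl' := fundamentalForm_closed hG' hJ' hskew' hpar' (fderiv ℝ F y u) (fderiv ℝ F y v)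
    (fderiv ℝ F y w)
  linear_combination e1 + e2 + e3 + hcl' - c y * hcl

end FundamentalForm

end LocalMetric

/-! ### Tensor fields in charts -/

theorem contDiffAt_clm_of_apply {D E F : Type*} [NormedAddCommGroup D] [NormedSpace ℝ D]
    [NormedAddCommGroup E] [NormedSpace ℝ E] [FiniteDimensional ℝ E] [NormedAddCommGroup F]
    [NormedSpace ℝ F] {n : WithTop ℕ∞} {f : D → E →L[ℝ] F} {x : D}
    (h : ∀ e, ContDiffAt ℝ n (fun z => f z e) x) : ContDiffAt ℝ n f x := by
  let d := Module.finrank ℝ E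
  have hd : d = Module.finrank ℝ (Fin d → ℝ) := (Module.finrank_fin_fun ℝ).symm
  let e₁ := ContinuousLinearEquiv.ofFinrankEq hd
  let e₂ := (e₁.arrowCongr (1 : F ≃L[ℝ] F)).trans (ContinuousLinearEquiv.piRing (Fin d))
  rw [← Function.id_comp f, ← e₂.symm_comp_self]
  exact e₂.symm.contDiff.contDiffAt.comp x (contDiffAt_pi.mpr fun i => h _)

section Charts

variable {E : Type*} [NormedAddCommGroup E] [NormedSpace ℝ E]
  {M : Type*} [TopologicalSpace M] [ChartedSpace E M]

theorem contMDiffAt_extChartAt_symm_of_mem [IsManifold 𝓘(ℝ, E) ∞ M] (p : M) {y : E}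
    (hy : y ∈ (extChartAt 𝓘(ℝ, E) p).target) :
    ContMDiffAt 𝓘(ℝ, E) 𝓘(ℝ, E) ∞ (extChartAt 𝓘(ℝ, E) p).symm y :=
  (contMDiffOn_extChartAt_symm p).contMDiffAt ((isOpen_extChartAt_target p).mem_nhds hy)

theorem mdifferentiableAt_extChartAt_symm_of_mem [IsManifold 𝓘(ℝ, E) ∞ M] (p : M) {y : E}
    (hy : y ∈ (extChartAt 𝓘(ℝ, E) p).target) :
    MDifferentiableAt 𝓘(ℝ, E) 𝓘(ℝ, E) (extChartAt 𝓘(ℝ, E) p).symm y :=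
  (contMDiffAt_extChartAt_symm_of_mem p hy).mdifferentiableAt (by simp)

theorem mfderiv_extChartAt_mfderiv_symm [IsManifold 𝓘(ℝ, E) 1 M] (p : M) {y : E}
    (hy : y ∈ (extChartAt 𝓘(ℝ, E) p).target) (v : E) :
    mfderiv 𝓘(ℝ, E) 𝓘(ℝ, E) (extChartAt 𝓘(ℝ, E) p) ((extChartAt 𝓘(ℝ, E) p).symm y)
      (mfderiv 𝓘(ℝ, E) 𝓘(ℝ, E) (extChartAt 𝓘(ℝ, E) p).symm y v) = v := by
  have h := mfderiv_extChartAt_comp_mfderivWithin_extChartAt_symm (I := 𝓘(ℝ, E)) hy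
  rw [modelWithCornersSelf_coe, Set.range_id, mfderivWithin_univ] at h
  exact DFunLike.congr_fun h v

theorem mfderiv_symm_mfderiv_extChartAt [IsManifold 𝓘(ℝ, E) 1 M] (p : M) {y : E}
    (hy : y ∈ (extChartAt 𝓘(ℝ, E) p).target)
    (v : TangentSpace 𝓘(ℝ, E) ((extChartAt 𝓘(ℝ, E) p).symm y)) :
    mfderiv 𝓘(ℝ, E) 𝓘(ℝ, E) (extChartAt 𝓘(ℝ, E) p).symm y
      (mfderiv 𝓘(ℝ, E) 𝓘(ℝ, E) (extChartAt 𝓘(ℝ, E) p) ((extChartAt 𝓘(ℝ, E) p).symm y) v)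
      = v := by
  have h := mfderivWithin_extChartAt_symm_comp_mfderiv_extChartAt (I := 𝓘(ℝ, E)) hy
  rw [modelWithCornersSelf_coe, Set.range_id, mfderivWithin_univ] at h
  exact DFunLike.congr_fun h v

theorem extChartAt_target_eventually (p : M) :
    ∀ᶠ y in 𝓝 (extChartAt 𝓘(ℝ, E) p p), y ∈ (extChartAt 𝓘(ℝ, E) p).target :=
  (isOpen_extChartAt_target p).mem_nhds (mem_extChartAt_target p)

/-- Coordinate vector fields are smooth. -/
theorem contMDiffAt_coordinateField [IsManifold 𝓘(ℝ, E) ∞ M] (p : M) {y : E}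
    (hy : y ∈ (extChartAt 𝓘(ℝ, E) p).target) (v : E) :
    ContMDiffAt 𝓘(ℝ, E) (𝓘(ℝ, E).prod 𝓘(ℝ, E)) ∞
      (fun z => TotalSpace.mk' E (E := fun q : M => TangentSpace 𝓘(ℝ, E) q)
        ((extChartAt 𝓘(ℝ, E) p).symm z)
        (mfderiv 𝓘(ℝ, E) 𝓘(ℝ, E) (extChartAt 𝓘(ℝ, E) p).symm z v)) y := by
  have hopen : IsOpen (extChartAt 𝓘(ℝ, E) p).target := isOpen_extChartAt_target p
  have h1 := (contMDiffOn_extChartAt_symm (I := 𝓘(ℝ, E)) (n := ∞)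
    p).contMDiffOn_tangentMapWithin (m := ∞) (by simp) hopen.uniqueMDiffOn
  have h2 : ContMDiffAt 𝓘(ℝ, E) (𝓘(ℝ, E).prod 𝓘(ℝ, E)) ∞
      (fun z => (⟨z, v⟩ : TangentBundle 𝓘(ℝ, E) E)) y :=
    contMDiffAt_vectorSpace_iff_contDiffAt.2 contDiffAt_const
  have h3 := (h1.contMDiffAt (x := (⟨y, v⟩ : TangentBundle 𝓘(ℝ, E) E))
    ((hopen.preimage (FiberBundle.continuous_proj E (TangentSpace 𝓘(ℝ, E)))).mem_nhds hy)).comp y h2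
  refine h3.congr_of_eventuallyEq ?_
  filter_upwards [hopen.mem_nhds hy] with z hz
  simp only [Function.comp_apply, tangentMapWithin]
  rw [mfderivWithin_of_isOpen hopen hz]

/-- The coordinate frame of the preferred chart at `p`. -/
def chartFrame (p : M) (y : E) :
    E →L[ℝ] TangentSpace 𝓘(ℝ, E) ((extChartAt 𝓘(ℝ, E) p).symm y) :=
  mfderiv 𝓘(ℝ, E) 𝓘(ℝ, E) (extChartAt 𝓘(ℝ, E) p).symm y

theorem chartFrame_bijective [IsManifold 𝓘(ℝ, E) ∞ M] (p : M) {y : E}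
    (hy : y ∈ (extChartAt 𝓘(ℝ, E) p).target) : Function.Bijective (chartFrame p y) :=
  have : IsManifold 𝓘(ℝ, E) 1 M := IsManifold.of_le (n := ∞) (by simp)
  ⟨Function.LeftInverse.injective (mfderiv_extChartAt_mfderiv_symm p hy),
    Function.RightInverse.surjective (mfderiv_symm_mfderiv_extChartAt p hy)⟩

end Charts

/-! ### Kähler data in coordinates -/

namespace IndefiniteKahler

open PseudoRiemannian

variable {E : Type*} [NormedAddCommGroup E] [NormedSpace ℝ E]
  {M : Type*} [TopologicalSpace M] [ChartedSpace E M] [IsManifold 𝓘(ℝ, E) ∞ M]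
  (S : IndefiniteKahler E M) (p : M)

theorem metricInChart_apply (y v w : E) : metricInChart S.g p y v w =
    S.g ((extChartAt 𝓘(ℝ, E) p).symm y)
      (chartFrame p y v)
      (chartFrame p y w) :=
  rfl

theorem metricInChart_symm (y v w : E) :
    metricInChart S.g p y v w = metricInChart S.g p y w v := by
  rw [metricInChart_apply, metricInChart_apply, S.g_symm]

theorem chartFrame_endInChart {y : E} (hy : y ∈ (extChartAt 𝓘(ℝ, E) p).target) (v : E) :
    chartFrame p y (endInChart S.J p y v) =
      S.J ((extChartAt 𝓘(ℝ, E) p).symm y)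
        (chartFrame p y v) :=
  have : IsManifold 𝓘(ℝ, E) 1 M := IsManifold.of_le (n := ∞) (by simp)
  mfderiv_symm_mfderiv_extChartAt p hy _

theorem metricInChart_nondegenerate {y : E} (hy : y ∈ (extChartAt 𝓘(ℝ, E) p).target) {v : E}
    (h : ∀ w, metricInChart S.g p y v w = 0) : v = 0 := by
  have hb := chartFrame_bijective p hy
  refine hb.1 ?_
  rw [map_zero]
  refine S.g_nondegenerate _ _ fun w => ?_
  obtain ⟨w, rfl⟩ := hb.2 w
  exact h w

theorem metricInChart_endInChart {y : E} (hy : y ∈ (extChartAt 𝓘(ℝ, E) p).target) (v w : E) :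
    metricInChart S.g p y (endInChart S.J p y v) (endInChart S.J p y w)
      = metricInChart S.g p y v w := by
  rw [metricInChart_apply, chartFrame_endInChart S p hy, chartFrame_endInChart S p hy, S.g_J]
  rfl

theorem endInChart_sq {y : E} (hy : y ∈ (extChartAt 𝓘(ℝ, E) p).target) (v : E) :
    endInChart S.J p y (endInChart S.J p y v) = -v := by
  refine (chartFrame_bijective p hy).1 ?_
  rw [chartFrame_endInChart S p hy, chartFrame_endInChart S p hy, S.J_sq]
  exact (map_neg (chartFrame p y) v).symm

theorem endInChart_skew {y : E} (hy : y ∈ (extChartAt 𝓘(ℝ, E) p).target) (v w : E) :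
    metricInChart S.g p y (endInChart S.J p y v) w
      = -metricInChart S.g p y v (endInChart S.J p y w) := by
  rw [hermitian_apply_right (S.endInChart_sq p hy) (S.metricInChart_endInChart p hy), neg_neg]

theorem contDiffAt_metricInChart [FiniteDimensional ℝ E] :
    ContDiffAt ℝ ∞ (metricInChart S.g p) (extChartAt 𝓘(ℝ, E) p p) := by
  have hy := mem_extChartAt_target (I := 𝓘(ℝ, E)) p
  refine contDiffAt_clm_of_apply fun v => contDiffAt_clm_of_apply fun w => ?_
  have hg := S.g_smooth.contMDiffAt.comp _ (contMDiffAt_extChartAt_symm_of_mem p hy)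
  have h : ContMDiffAt 𝓘(ℝ, E) (𝓘(ℝ, E).prod 𝓘(ℝ)) ∞
      (fun y => TotalSpace.mk' ℝ (E := Bundle.Trivial M ℝ) ((extChartAt 𝓘(ℝ, E) p).symm y)
        (S.g ((extChartAt 𝓘(ℝ, E) p).symm y)
          (chartFrame p y v)
          (chartFrame p y w)))
      (extChartAt 𝓘(ℝ, E) p p) := by
    apply ContMDiffAt.clm_bundle_apply₂ (F₁ := E) (F₂ := E)
    · exact hg
    · exact contMDiffAt_coordinateField p hy v
    · exact contMDiffAt_coordinateField p hy w
  rw [contMDiffAt_totalSpace] at h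
  exact h.2.contDiffAt

theorem contDiffAt_endInChart [FiniteDimensional ℝ E] :
    ContDiffAt ℝ ∞ (endInChart S.J p) (extChartAt 𝓘(ℝ, E) p p) := by
  have : IsManifold 𝓘(ℝ, E) 1 M := IsManifold.of_le (n := ∞) (by simp)
  have hy := mem_extChartAt_target (I := 𝓘(ℝ, E)) p
  refine contDiffAt_clm_of_apply fun v => ?_
  have hJ := S.J_smooth.contMDiffAt.comp _ (contMDiffAt_extChartAt_symm_of_mem p hy)
  have h : ContMDiffAt 𝓘(ℝ, E) (𝓘(ℝ, E).prod 𝓘(ℝ, E)) ∞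
      (fun y => TotalSpace.mk' E (E := fun q : M => TangentSpace 𝓘(ℝ, E) q)
        ((extChartAt 𝓘(ℝ, E) p).symm y)
        (S.J ((extChartAt 𝓘(ℝ, E) p).symm y)
          (chartFrame p y v)))
      (extChartAt 𝓘(ℝ, E) p p) := by
    apply ContMDiffAt.clm_bundle_apply (F₁ := E) (F₂ := E)
    · exact hJ
    · exact contMDiffAt_coordinateField p hy v
  rw [contMDiffAt_totalSpace] at h
  refine h.2.contDiffAt.congr_of_eventuallyEq ?_
  filter_upwards [extChartAt_target_eventually p] with y hy
  have hsrc : (extChartAt 𝓘(ℝ, E) p).symm y ∈ (chartAt E p).source := by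
    rw [← extChartAt_source 𝓘(ℝ, E)]
    exact (extChartAt 𝓘(ℝ, E) p).map_target hy
  simp only [extChartAt_to_inv]
  -- The tangent bundle trivialisation at `p` is the derivative of the chart at `p`, so the fibre
  -- coordinate of the section is `endInChart` applied to `v`.
  have e := TangentBundle.continuousLinearMapAt_trivializationAt (I := 𝓘(ℝ, E)) hsrc
  have e2 := DFunLike.congr_fun e (S.J ((extChartAt 𝓘(ℝ, E) p).symm y)
          (chartFrame p y v))
  refine Eq.trans e2.symm ?_
  rw [Trivialization.continuousLinearMapAt_apply, Trivialization.coe_linearMapAt_of_mem]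
  simpa using hsrc

theorem isRegularAt_metricInChart [FiniteDimensional ℝ E] :
    LocalMetric.IsRegularAt (metricInChart S.g p) (extChartAt 𝓘(ℝ, E) p p) where
  contDiffAt := (S.contDiffAt_metricInChart p).of_le (by exact WithTop.coe_le_coe.2 le_top)
  symm := Eventually.of_forall fun y => S.metricInChart_symm p y
  isInvertible := by
    filter_upwards [extChartAt_target_eventually p] with y hy
    have hinj : Function.Injective (metricInChart S.g p y) := by
      rw [injective_iff_map_eq_zero]
      intro v hv
      exact S.metricInChart_nondegenerate p hy fun w => by rw [hv]; rfl
    have hfin : Module.finrank ℝ E = Module.finrank ℝ (E →L[ℝ] ℝ) := by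
      rw [← (LinearMap.toContinuousLinearMap : (E →ₗ[ℝ] ℝ) ≃ₗ[ℝ] (E →L[ℝ] ℝ)).finrank_eq]
      exact (Subspace.dual_finrank_eq (K := ℝ) (V := E)).symm
    exact ⟨(LinearEquiv.ofInjectiveOfFinrankEq (metricInChart S.g p y).toLinearMap hinj
      hfin).toContinuousLinearEquiv, by ext; rfl⟩

end IndefiniteKahler

/-! ### Diffeomorphisms in charts -/

section MapsInCharts

variable {E : Type*} [NormedAddCommGroup E] [NormedSpace ℝ E]
  {M : Type*} [TopologicalSpace M] [ChartedSpace E M] [IsManifold 𝓘(ℝ, E) ∞ M]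
  {M' : Type*} [TopologicalSpace M'] [ChartedSpace E M'] [IsManifold 𝓘(ℝ, E) ∞ M']

/-- The coordinate expression of `f` in the preferred charts at `p` and `f p`. -/
def mapInCharts (f : M → M') (p : M) (y : E) : E :=
  extChartAt 𝓘(ℝ, E) (f p) (f ((extChartAt 𝓘(ℝ, E) p).symm y))

theorem mapInCharts_self (f : M → M') (p : M) :
    mapInCharts f p (extChartAt 𝓘(ℝ, E) p p) = extChartAt 𝓘(ℝ, E) (f p) (f p) := by
  rw [mapInCharts, extChartAt_to_inv]

theorem contDiffAt_mapInCharts {f : M → M'} (hf : ContMDiff 𝓘(ℝ, E) 𝓘(ℝ, E) ∞ f) (p : M) :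
    ContDiffAt ℝ ∞ (mapInCharts f p) (extChartAt 𝓘(ℝ, E) p p) := by
  have h := (contMDiffAt_iff.1 (hf p)).2
  rwa [modelWithCornersSelf_coe, Set.range_id, contDiffWithinAt_univ] at h

/-- The data of `f` at a point are read off from its coordinate expression. -/
structure IsGoodChartPoint (f : M → M') (p : M) (y : E) : Prop where
  mem_target : y ∈ (extChartAt 𝓘(ℝ, E) p).target
  map_mem_target : mapInCharts f p y ∈ (extChartAt 𝓘(ℝ, E) (f p)).target
  symm_map : (extChartAt 𝓘(ℝ, E) (f p)).symm (mapInCharts f p y) =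
    f ((extChartAt 𝓘(ℝ, E) p).symm y)
  chartFrame_fderiv : ∀ v : E,
    (chartFrame (f p) (mapInCharts f p y) (fderiv ℝ (mapInCharts f p) y v) : E) =
      mfderiv 𝓘(ℝ, E) 𝓘(ℝ, E) f ((extChartAt 𝓘(ℝ, E) p).symm y) (chartFrame p y v)

theorem eventually_isGoodChartPoint {f : M → M'} (hf : ContMDiff 𝓘(ℝ, E) 𝓘(ℝ, E) ∞ f) (p : M) :
    ∀ᶠ y in 𝓝 (extChartAt 𝓘(ℝ, E) p p), IsGoodChartPoint f p y := by
  have hcd := contDiffAt_mapInCharts hf p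
  have hcont : ContinuousAt (fun y => f ((extChartAt 𝓘(ℝ, E) p).symm y))
      (extChartAt 𝓘(ℝ, E) p p) :=
    hf.continuous.continuousAt.comp (continuousAt_extChartAt_symm p)
  have hsrc : ∀ᶠ y in 𝓝 (extChartAt 𝓘(ℝ, E) p p),
      f ((extChartAt 𝓘(ℝ, E) p).symm y) ∈ (extChartAt 𝓘(ℝ, E) (f p)).source := by
    refine hcont.eventually ((isOpen_extChartAt_source (f p)).mem_nhds ?_)
    simpa only [extChartAt_to_inv] using mem_extChartAt_source (f p)
  have hcd1 : ∀ᶠ y in 𝓝 (extChartAt 𝓘(ℝ, E) p p), ContDiffAt ℝ 1 (mapInCharts f p) y :=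
    (hcd.of_le (m := 1) (by exact WithTop.coe_le_coe.2 le_top)).eventually (by simp)
  filter_upwards [extChartAt_target_eventually p, hsrc.eventually_nhds, hcd1] with y hy hys hy1
  have hys' := hys.self_of_nhds
  have hmt : mapInCharts f p y ∈ (extChartAt 𝓘(ℝ, E) (f p)).target :=
    (extChartAt 𝓘(ℝ, E) (f p)).map_source hys'
  refine ⟨hy, hmt, (extChartAt 𝓘(ℝ, E) (f p)).left_inv hys', fun v => ?_⟩
  -- The identity holds on a neighbourhood of `y`, so both sides can be differentiated by the chain
  -- rule.
  have heq : ((extChartAt 𝓘(ℝ, E) (f p)).symm ∘ mapInCharts f p) =ᶠ[𝓝 y]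
      (f ∘ (extChartAt 𝓘(ℝ, E) p).symm) :=
    hys.mono fun z hz => (extChartAt 𝓘(ℝ, E) (f p)).left_inv hz
  have h1 := heq.mfderiv_eq (I := 𝓘(ℝ, E)) (I' := 𝓘(ℝ, E))
  rw [mfderiv_comp y (mdifferentiableAt_extChartAt_symm_of_mem (f p) hmt)
    (hy1.differentiableAt (by simp)).mdifferentiableAt,
    mfderiv_comp y (hf.mdifferentiableAt (by simp))
      (mdifferentiableAt_extChartAt_symm_of_mem p hy), mfderiv_eq_fderiv] at h1
  exact DFunLike.congr_fun h1 v

end MapsInCharts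

/-! ### Intertwining and conformality read in charts -/

namespace IndefiniteKahler

open PseudoRiemannian

variable {E : Type*} [NormedAddCommGroup E] [NormedSpace ℝ E]
  {M : Type*} [TopologicalSpace M] [ChartedSpace E M] [IsManifold 𝓘(ℝ, E) ∞ M]
  {M' : Type*} [TopologicalSpace M'] [ChartedSpace E M'] [IsManifold 𝓘(ℝ, E) ∞ M']
  (S : IndefiniteKahler E M) (S' : IndefiniteKahler E M') {f : M → M'} {p : M} {y : E}

/-- Every tangent space unfolds to `E`, so values at two equal base points can be compared without
transporting vectors. -/
theorem g_congr {q q' : M} (h : q = q') (v w : E) : (S.g q v w : ℝ) = S.g q' v w := by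
  subst h; rfl

theorem J_congr {q q' : M} (h : q = q') (v : E) : (S.J q v : E) = S.J q' v := by
  subst h; rfl

theorem metricInChart_mapInCharts (h : IsGoodChartPoint f p y) (v w : E) :
    metricInChart S'.g (f p) (mapInCharts f p y) (fderiv ℝ (mapInCharts f p) y v)
      (fderiv ℝ (mapInCharts f p) y w) =
    S'.g (f ((extChartAt 𝓘(ℝ, E) p).symm y))
      (mfderiv 𝓘(ℝ, E) 𝓘(ℝ, E) f ((extChartAt 𝓘(ℝ, E) p).symm y) (chartFrame p y v))
      (mfderiv 𝓘(ℝ, E) 𝓘(ℝ, E) f ((extChartAt 𝓘(ℝ, E) p).symm y) (chartFrame p y w)) := by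
  have h1 := S'.g_congr h.symm_map
    (chartFrame (f p) (mapInCharts f p y) (fderiv ℝ (mapInCharts f p) y v))
    (chartFrame (f p) (mapInCharts f p y) (fderiv ℝ (mapInCharts f p) y w))
  rw [h.chartFrame_fderiv v, h.chartFrame_fderiv w] at h1
  rw [← h1, ← h.chartFrame_fderiv v, ← h.chartFrame_fderiv w]
  rfl

theorem chartFrame_endInChart_mapInCharts (h : IsGoodChartPoint f p y) (v : E) :
    (chartFrame (f p) (mapInCharts f p y) (endInChart S'.J (f p) (mapInCharts f p y)
      (fderiv ℝ (mapInCharts f p) y v)) : E) =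
    S'.J (f ((extChartAt 𝓘(ℝ, E) p).symm y))
      (mfderiv 𝓘(ℝ, E) 𝓘(ℝ, E) f ((extChartAt 𝓘(ℝ, E) p).symm y) (chartFrame p y v)) := by
  have h1 := S'.J_congr h.symm_map
    (chartFrame (f p) (mapInCharts f p y) (fderiv ℝ (mapInCharts f p) y v))
  rw [h.chartFrame_fderiv v] at h1
  rw [← h1, ← h.chartFrame_fderiv v]
  exact S'.chartFrame_endInChart (f p) h.map_mem_target _

/-- `f_* J = ε J' f_*` at the point `q`. -/
def IntertwinesAt (f : M → M') (ε : ℝ) (q : M) : Prop :=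
  ∀ x : TangentSpace 𝓘(ℝ, E) q, mfderiv 𝓘(ℝ, E) 𝓘(ℝ, E) f q (S.J q x) =
    ε • S'.J (f q) (mfderiv 𝓘(ℝ, E) 𝓘(ℝ, E) f q x)

/-- `f^* g' = c g` at the point `q`. -/
def ConformalAt (f : M → M') (c : ℝ) (q : M) : Prop :=
  ∀ x y : TangentSpace 𝓘(ℝ, E) q, S'.g (f q) (mfderiv 𝓘(ℝ, E) 𝓘(ℝ, E) f q x)
    (mfderiv 𝓘(ℝ, E) 𝓘(ℝ, E) f q y) = c * S.g q x y

theorem intertwinesAt_iff (h : IsGoodChartPoint f p y) (ε : ℝ) :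
    S.IntertwinesAt S' f ε ((extChartAt 𝓘(ℝ, E) p).symm y) ↔
      ∀ v, fderiv ℝ (mapInCharts f p) y (endInChart S.J p y v) =
        ε • endInChart S'.J (f p) (mapInCharts f p y) (fderiv ℝ (mapInCharts f p) y v) := by
  have hb := chartFrame_bijective p h.mem_target
  have hb' := chartFrame_bijective (f p) h.map_mem_target
  have key : ∀ v, (fderiv ℝ (mapInCharts f p) y (endInChart S.J p y v) =
        ε • endInChart S'.J (f p) (mapInCharts f p y) (fderiv ℝ (mapInCharts f p) y v)) ↔
      mfderiv 𝓘(ℝ, E) 𝓘(ℝ, E) f ((extChartAt 𝓘(ℝ, E) p).symm y)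
        (S.J _ (chartFrame p y v)) = ε • S'.J (f ((extChartAt 𝓘(ℝ, E) p).symm y))
      (mfderiv 𝓘(ℝ, E) 𝓘(ℝ, E) f ((extChartAt 𝓘(ℝ, E) p).symm y) (chartFrame p y v)) := by
    intro v
    rw [← hb'.1.eq_iff, map_smul]
    have e1 := h.chartFrame_fderiv (endInChart S.J p y v)
    rw [S.chartFrame_endInChart p h.mem_target] at e1
    have e2 := S'.chartFrame_endInChart_mapInCharts h v
    exact ⟨fun hh => e1.symm.trans (hh.trans (congrArg (fun z : E => ε • z) e2)),
      fun hh => e1.trans (hh.trans (congrArg (fun z : E => ε • z) e2.symm))⟩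
  constructor
  · intro hi v
    exact (key v).2 (hi _)
  · intro hi x
    obtain ⟨v, rfl⟩ := hb.2 x
    exact (key v).1 (hi v)

theorem conformalAt_iff (h : IsGoodChartPoint f p y) (c : ℝ) :
    S.ConformalAt S' f c ((extChartAt 𝓘(ℝ, E) p).symm y) ↔
      ∀ v w, metricInChart S'.g (f p) (mapInCharts f p y) (fderiv ℝ (mapInCharts f p) y v)
        (fderiv ℝ (mapInCharts f p) y w) = c * metricInChart S.g p y v w := by
  have hb := chartFrame_bijective p h.mem_target
  constructor
  · intro hi v w
    rw [S'.metricInChart_mapInCharts h, hi, metricInChart_apply]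
  · intro hi x x'
    obtain ⟨v, rfl⟩ := hb.2 x
    obtain ⟨w, rfl⟩ := hb.2 x'
    rw [← S'.metricInChart_mapInCharts h, hi, metricInChart_apply]

theorem fderiv_mapInCharts_surjective (h : IsGoodChartPoint f p y)
    (hf : Function.Surjective
      (mfderiv 𝓘(ℝ, E) 𝓘(ℝ, E) f ((extChartAt 𝓘(ℝ, E) p).symm y))) :
    Function.Surjective (fderiv ℝ (mapInCharts f p) y) := by
  have hb := chartFrame_bijective p h.mem_target
  have hb' := chartFrame_bijective (f p) h.map_mem_target
  intro u
  obtain ⟨x, hx⟩ := hf (chartFrame (f p) (mapInCharts f p y) u)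
  obtain ⟨v, rfl⟩ := hb.2 x
  exact ⟨v, hb'.1 ((h.chartFrame_fderiv v).trans hx)⟩

end IndefiniteKahler

/-! ### The quartic form of the curvature tensor -/

section Quartic

variable {E : Type*} [NormedAddCommGroup E] [NormedSpace ℝ E]

theorem isQuartic_of_multilinear (T : E → E → E → E → ℝ)
    (h₁ : ∀ (s t : ℝ) (a b x y z : E), T (s • a + t • b) x y z = s * T a x y z + t * T b x y z)
    (h₂ : ∀ (s t : ℝ) (a b x y z : E), T x (s • a + t • b) y z = s * T x a y z + t * T x b y z)
    (h₃ : ∀ (s t : ℝ) (a b x y z : E), T x y (s • a + t • b) z = s * T x y a z + t * T x y b z)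
    (h₄ : ∀ (s t : ℝ) (a b x y z : E), T x y z (s • a + t • b) = s * T x y z a + t * T x y z b) :
    IsQuartic fun x => T x x x x := by
  intro x y
  refine ⟨T x x x x, T y x x x + T x y x x + T x x y x + T x x x y,
    T y y x x + T y x y x + T y x x y + T x y y x + T x y x y + T x x y y,
    T x y y y + T y x y y + T y y x y + T y y y x, T y y y y, fun s t => ?_⟩
  simp only [h₁]
  simp only [h₂]
  simp only [h₃]
  simp only [h₄]
  ring

/-- If `P / g²` is not constant then some isotropic vector of `g` is a limit of vectors at which
neither `P` nor `g` vanishes. -/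
theorem exists_isotropic_frequently_ne_zero {P : E → ℝ} {g : E →L[ℝ] E →L[ℝ] ℝ} (hP : IsQuartic P)
    (hg : ∀ x y, g x y = g y x) (hpos : ∃ x, 0 < g x x) (hneg : ∃ x, g x x < 0)
    (hnc : ¬ ∃ c, ∀ x, g x x ≠ 0 → P x / g x x ^ 2 = c) :
    ∃ ξ, g ξ ξ = 0 ∧ ξ ≠ 0 ∧ ∃ᶠ x in 𝓝 ξ, g x x ≠ 0 ∧ P x ≠ 0 := by
  obtain ⟨x, hx⟩ := hpos
  obtain ⟨y, hy⟩ := hneg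
  obtain ⟨t, -, -, ht, -⟩ := exists_isotropic_pair hg hx hy
  obtain ⟨z, hz, hPz⟩ : ∃ z, g z z ≠ 0 ∧ P z ≠ 0 := by
    by_contra! hcon
    exact hnc ⟨0, fun z hz => by rw [hcon z hz, zero_div]⟩
  refine ⟨x + t • y, ht, ?_, ?_⟩
  · intro h0
    have hxe : x = (-t) • y := by
      rw [neg_smul]; exact eq_neg_of_add_eq_zero_left h0
    rw [hxe] at hx
    simp only [map_smul, smul_apply, smul_eq_mul] at hx
    nlinarith [sq_nonneg t]
  · set ξ := x + t • y
    obtain ⟨a₀, a₁, a₂, a₃, a₄, ha⟩ := hP (z - ξ) ξ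
    have hX : ∀ r : ℝ, ξ + r • (z - ξ) = r • (z - ξ) + (1 : ℝ) • ξ := fun r => by module
    -- The product `P g` along the segment from `ξ` to `z` is a polynomial that is nonzero at `r =
    -- 1`, hence nonzero for all small `r ≠ 0`.
    let Q : ℝ → ℝ := fun r => (a₀ * r ^ 4 + a₁ * r ^ 3 + a₂ * r ^ 2 + a₃ * r + a₄) *
      (g ξ ξ + 2 * r * g ξ (z - ξ) + r ^ 2 * g (z - ξ) (z - ξ))
    have hQ : ∀ r, Q r = P (ξ + r • (z - ξ)) * g (ξ + r • (z - ξ)) (ξ + r • (z - ξ)) := by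
      intro r
      rw [quadratic_add_smul hg, hX, ha]
      simp only [Q]
      ring
    have hQa : AnalyticOnNhd ℝ Q Set.univ := by intro r _; fun_prop
    have hQ1 : Q 1 ≠ 0 := by
      rw [hQ, one_smul, add_sub_cancel]
      exact mul_ne_zero hPz hz
    have hev : ∀ᶠ r : ℝ in 𝓝[≠] 0, Q r ≠ 0 := by
      by_contra hfr
      simp only [not_eventually, not_not] at hfr
      exact hQ1 (hQa.eqOn_zero_of_preconnected_of_frequently_eq_zero isPreconnected_univ
        (Set.mem_univ 0) hfr (Set.mem_univ 1))
    have hlim : Tendsto (fun r : ℝ => ξ + r • (z - ξ)) (𝓝[≠] 0) (𝓝 ξ) := by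
      have : Continuous fun r : ℝ => ξ + r • (z - ξ) := by fun_prop
      have h0 := this.tendsto 0
      simp only [zero_smul, add_zero] at h0
      exact h0.mono_left nhdsWithin_le_nhds
    refine hlim.frequently (Eventually.frequently (hev.mono fun r hr => ?_))
    rw [hQ] at hr
    exact ⟨right_ne_zero_of_mul hr, left_ne_zero_of_mul hr⟩

variable [CompleteSpace E] {G : E → E →L[ℝ] E →L[ℝ] ℝ} {y : E}

theorem LocalMetric.IsRegularAt.isQuartic_curvature (h : IsRegularAt G y) (L : E →L[ℝ] E) :
    IsQuartic fun x => G y (curvatureOperator G y x (L x) (L x)) x := by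
  refine isQuartic_of_multilinear (fun a b c d => G y (curvatureOperator G y a (L b) (L c)) d)
    ?_ ?_ ?_ ?_ <;> intro s t a b x y z <;>
  simp only [h.curvatureOperator_eq, map_add, map_sub, map_smul, add_apply, sub_apply, smul_apply,
    smul_eq_mul] <;>
  ring

theorem LocalMetric.IsRegularAt.continuous_curvature (h : IsRegularAt G y) (L : E →L[ℝ] E) :
    Continuous fun x => G y (curvatureOperator G y x (L x) (L x)) x := by
  simp only [h.curvatureOperator_eq]
  fun_prop

end Quartic

/-! ### Holomorphic sectional curvature as a quartic over `g²` -/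

namespace IndefiniteKahler

open PseudoRiemannian

variable {E : Type*} [NormedAddCommGroup E] [NormedSpace ℝ E]
  {M : Type*} [TopologicalSpace M] [ChartedSpace E M] [IsManifold 𝓘(ℝ, E) ∞ M]
  {M' : Type*} [TopologicalSpace M'] [ChartedSpace E M'] [IsManifold 𝓘(ℝ, E) ∞ M']
  (S : IndefiniteKahler E M) (S' : IndefiniteKahler E M') (p : M)

/-- The preferred chart at `p` has identity derivative at `p`, since the tangent space there is
modelled on that chart. -/
theorem curvatureTensor_eq (x y z w : E) : curvatureTensor S.g p x y z w =
    metricInChart S.g p (extChartAt 𝓘(ℝ, E) p p)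
      (LocalMetric.curvatureOperator (metricInChart S.g p) (extChartAt 𝓘(ℝ, E) p p) x y z) w := by
  have : IsManifold 𝓘(ℝ, E) 1 M := IsManifold.of_le (n := ∞) (by simp)
  let D : E →L[ℝ] E := mfderiv 𝓘(ℝ, E) 𝓘(ℝ, E) (extChartAt 𝓘(ℝ, E) p) p
  have hD : D = ContinuousLinearMap.id ℝ E := mfderiv_extChartAt_self
  change metricInChart S.g p (extChartAt 𝓘(ℝ, E) p p)
    (LocalMetric.curvatureOperator (metricInChart S.g p) (extChartAt 𝓘(ℝ, E) p p) (D x) (D y) (D z))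
      (D w) = _
  rw [hD]
  rfl

theorem holCurv_eq (x : TangentSpace 𝓘(ℝ, E) p) : S.holCurv p x =
    curvatureTensor S.g p x (S.J p x) (S.J p x) x / S.g p x x ^ 2 := by
  have h : S.g p x (S.J p x) = 0 :=
    hermitian_self_apply (E := E) (g := S.g p) (J := S.J p) (S.g_symm p) (S.J_sq p) (S.g_J p) x
  rw [holCurv, sectionalCurvature, piOne, S.g_J, h]
  ring

/-- The quartic form `x ↦ R(x, Jx, Jx, x)`. -/
def holQuartic (x : E) : ℝ := curvatureTensor S.g p x (S.J p x) (S.J p x) x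

theorem isQuartic_holQuartic [FiniteDimensional ℝ E] : IsQuartic (S.holQuartic p) := by
  have := FiniteDimensional.complete ℝ E
  have h := (S.isRegularAt_metricInChart p).isQuartic_curvature (S.J p)
  refine cast (congrArg IsQuartic (funext fun x => ?_)) h
  exact (S.curvatureTensor_eq p x (S.J p x) (S.J p x) x).symm

theorem continuous_holQuartic [FiniteDimensional ℝ E] : Continuous (S.holQuartic p) := by
  have := FiniteDimensional.complete ℝ E
  have h := (S.isRegularAt_metricInChart p).continuous_curvature (S.J p)
  refine h.congr fun x => ?_
  exact (S.curvatureTensor_eq p x (S.J p x) (S.J p x) x).symm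

theorem fderiv_mapInCharts_self {f : M → M'} (hf : ContMDiff 𝓘(ℝ, E) 𝓘(ℝ, E) ∞ f) (v : E) :
    fderiv ℝ (mapInCharts f p) (extChartAt 𝓘(ℝ, E) p p) v = mfderiv 𝓘(ℝ, E) 𝓘(ℝ, E) f p v := by
  rw [(hf.mdifferentiableAt (by simp) : MDifferentiableAt 𝓘(ℝ, E) 𝓘(ℝ, E) f p).mfderiv,
    modelWithCornersSelf_coe, Set.range_id, fderivWithin_univ]
  rfl

end IndefiniteKahler

/-! ### Functions with vanishing differential -/

section LocallyConstant

variable {E : Type*} [NormedAddCommGroup E] [NormedSpace ℝ E]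
  {M : Type*} [TopologicalSpace M] [ChartedSpace E M]

theorem map_extChartAt_symm_nhds (p : M) :
    map (extChartAt 𝓘(ℝ, E) p).symm (𝓝 (extChartAt 𝓘(ℝ, E) p p)) = 𝓝 p := by
  have h := map_extChartAt_symm_nhdsWithin_range (I := 𝓘(ℝ, E)) p
  rwa [modelWithCornersSelf_coe, Set.range_id, nhdsWithin_univ] at h

/-- A function on a connected manifold whose differential vanishes is constant. -/
theorem eq_of_hasFDerivAt_zero_in_charts [IsManifold 𝓘(ℝ, E) ∞ M] [PreconnectedSpace M] {c : M → ℝ}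
    (h : ∀ p : M, HasFDerivAt (fun y : E => c ((extChartAt 𝓘(ℝ, E) p).symm y))
      (0 : E →L[ℝ] ℝ) (extChartAt 𝓘(ℝ, E) p p)) (p q : M) : c p = c q := by
  -- The hypothesis speaks only of the centre of each chart. As a statement about the manifold
  -- derivative at every point, it transfers by the chain rule to a whole ball in one chart.
  have hmf : ∀ p : M, HasMFDerivAt 𝓘(ℝ, E) 𝓘(ℝ, ℝ) c p (0 : E →L[ℝ] ℝ) := by
    intro p
    refine ⟨?_, ?_⟩
    · have h1 := (h p).continuousAt.comp (continuousAt_extChartAt (I := 𝓘(ℝ, E)) p)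
      refine h1.congr ?_
      filter_upwards [extChartAt_source_mem_nhds (I := 𝓘(ℝ, E)) p] with q hq
      simp only [Function.comp_apply]
      rw [(extChartAt 𝓘(ℝ, E) p).left_inv hq]
    · exact (h p).hasFDerivWithinAt
  refine IsLocallyConstant.apply_eq_of_preconnectedSpace
    ((IsLocallyConstant.iff_eventually_eq c).2 fun p => ?_) p q
  obtain ⟨r, hr, hball⟩ := Metric.isOpen_iff.1 (isOpen_extChartAt_target (I := 𝓘(ℝ, E)) p) _
    (mem_extChartAt_target p)
  have hd : ∀ y ∈ Metric.ball (extChartAt 𝓘(ℝ, E) p p) r,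
      HasFDerivAt (fun y : E => c ((extChartAt 𝓘(ℝ, E) p).symm y)) (0 : E →L[ℝ] ℝ) y := by
    intro y hy
    have h1 := (hmf ((extChartAt 𝓘(ℝ, E) p).symm y)).comp y
      (mdifferentiableAt_extChartAt_symm_of_mem p (hball hy)).hasMFDerivAt
    exact h1.hasFDerivAt.congr_fderiv (by ext v; rfl)
  have hev : ∀ᶠ y in 𝓝 (extChartAt 𝓘(ℝ, E) p p), c ((extChartAt 𝓘(ℝ, E) p).symm y) = c p := by
    filter_upwards [Metric.ball_mem_nhds _ hr] with y hy
    have h1 := Metric.isOpen_ball.is_const_of_fderiv_eq_zero (𝕜 := ℝ)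
      (convex_ball (extChartAt 𝓘(ℝ, E) p p) r).isPreconnected
      (fun z hz => (hd z hz).differentiableAt.differentiableWithinAt)
      (fun z hz => (hd z hz).fderiv) hy (Metric.mem_ball_self hr)
    rw [h1, extChartAt_to_inv]
  rw [← map_extChartAt_symm_nhds (E := E) p]
  exact hev

end LocallyConstant

/-! ### From pointwise conformality to isometry -/

namespace IndefiniteKahler

open PseudoRiemannian

variable {E : Type*} [NormedAddCommGroup E] [NormedSpace ℝ E] [FiniteDimensional ℝ E]
  {M : Type*} [TopologicalSpace M] [ChartedSpace E M] [IsManifold 𝓘(ℝ, E) ∞ M]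
  {M' : Type*} [TopologicalSpace M'] [ChartedSpace E M'] [IsManifold 𝓘(ℝ, E) ∞ M']
  (S : IndefiniteKahler E M) (S' : IndefiniteKahler E M')
  (f : M ≃ₘ^∞⟮𝓘(ℝ, E), 𝓘(ℝ, E)⟯ M')

theorem mfderiv_bijective (p : M) : Function.Bijective (mfderiv 𝓘(ℝ, E) 𝓘(ℝ, E) f p) :=
  (f.mfderivToContinuousLinearEquiv (by simp) p).bijective

theorem exists_g_ne_zero (p : M) : ∃ v : E, S.g p v v ≠ 0 :=
  let ⟨v, hv⟩ := S.g_pos p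
  ⟨v, hv.ne'⟩

/-- A diffeomorphism preserving holomorphic planes is pointwise complex linear or antilinear. -/
theorem intertwinesAt_or (hdim : 2 < Module.finrank ℝ E) (hplanes : S.MapsHolomorphicPlanes S' f)
    (p : M) : S.IntertwinesAt S' f 1 p ∨ S.IntertwinesAt S' f (-1) p := by
  let A : E ≃ₗ[ℝ] E := (f.mfderivToContinuousLinearEquiv (by simp) p).toLinearEquiv
  let J : E →ₗ[ℝ] E := (S.J p).toLinearMap
  let J₁ : E →ₗ[ℝ] E := (S'.J (f p)).toLinearMap
  have h := map_complexStructure_eq_or_eq_neg hdim (J := J) (J' := J₁) A (S.J_sq p) (S'.J_sq (f p))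
    (fun α h2 hα => (hplanes p α ⟨h2, hα⟩).2)
  refine h.imp (fun h x => ?_) (fun h x => ?_)
  · rw [one_smul]; exact h x
  · rw [neg_one_smul]; exact h x

theorem frequently_chart {s : Set M} {p : M} (h : ∃ᶠ q in 𝓝 p, q ∈ s) :
    ∃ᶠ y in 𝓝 (extChartAt 𝓘(ℝ, E) p p), (extChartAt 𝓘(ℝ, E) p).symm y ∈ s := by
  rw [← map_extChartAt_symm_nhds (E := E) p] at h
  exact h

theorem continuousAt_fderiv_mapInCharts (p : M) :
    ContinuousAt (fderiv ℝ (mapInCharts f p)) (extChartAt 𝓘(ℝ, E) p p) :=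
  ((contDiffAt_mapInCharts f.contMDiff p).fderiv_right (m := 1)
    (by exact WithTop.coe_le_coe.2 le_top)).continuousAt

theorem contDiffAt_mapInCharts_three (p : M) :
    ContDiffAt ℝ 3 (mapInCharts f p) (extChartAt 𝓘(ℝ, E) p p) :=
  (contDiffAt_mapInCharts f.contMDiff p).of_le (by exact WithTop.coe_le_coe.2 le_top)

theorem isClosed_intertwinesAt (ε : ℝ) : IsClosed {p | S.IntertwinesAt S' f ε p} := by
  refine isClosed_iff_frequently.2 fun p hp => ?_
  have hgood := eventually_isGoodChartPoint f.contMDiff p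
  have h0 := (S.intertwinesAt_iff S' hgood.self_of_nhds ε).2 (fun v => by
    have hF := (contDiffAt_mapInCharts f.contMDiff p).continuousAt
    have hJ := (S.contDiffAt_endInChart p).continuousAt
    have hJ' := (S'.contDiffAt_endInChart (f p)).continuousAt
    rw [← mapInCharts_self (E := E) f p] at hJ'
    have hJ'F := hJ'.comp hF
    have hA := continuousAt_fderiv_mapInCharts f p
    refine sub_eq_zero.1 (eq_zero_of_frequently_of_continuous (l := 𝓝 _)
      (F := fun y => fderiv ℝ (mapInCharts f p) y (endInChart S.J p y v) -
        ε • endInChart S'.J (f p) (mapInCharts f p y) (fderiv ℝ (mapInCharts f p) y v))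
      le_rfl ?_ (((frequently_chart hp).and_eventually hgood).mono fun y ⟨h1, h2⟩ =>
        sub_eq_zero.2 ((S.intertwinesAt_iff S' h2 ε).1 h1 v)))
    exact (hA.clm_apply (hJ.clm_apply continuousAt_const)).sub
      ((hJ'F.clm_apply (hA.clm_apply continuousAt_const)).const_smul ε))
  rw [extChartAt_to_inv] at h0
  exact h0

theorem not_intertwinesAt_both (p : M) (h₁ : S.IntertwinesAt S' f 1 p)
    (h₂ : S.IntertwinesAt S' f (-1) p) : False := by
  obtain ⟨v, hv⟩ := S.g_pos p
  have h3 := (h₁ v).symm.trans (h₂ v)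
  rw [one_smul, neg_one_smul] at h3
  have hself : ∀ a : E, a = -a → a = 0 := fun a ha => by
    have h2 : (2 : ℝ) • a = 0 := by linear_combination (norm := module) ha
    simpa using h2
  have h4 : S'.J (f p) (mfderiv 𝓘(ℝ, E) 𝓘(ℝ, E) f p v) = 0 := hself _ h3
  have h5 := S'.J_sq (f p) (mfderiv 𝓘(ℝ, E) 𝓘(ℝ, E) f p v)
  rw [h4, map_zero, zero_eq_neg] at h5
  have h6 : v = 0 := (mfderiv_bijective f p).1 (h5.trans (map_zero _).symm)
  rw [h6, map_zero] at hv
  exact lt_irrefl _ hv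

/-- The sets of points with either sign are closed, disjoint and cover `M`, so connectedness leaves
only one of them. -/
theorem intertwines_or [PreconnectedSpace M] (hdim : 2 < Module.finrank ℝ E)
    (hplanes : S.MapsHolomorphicPlanes S' f) :
    (∀ p, S.IntertwinesAt S' f 1 p) ∨ ∀ p, S.IntertwinesAt S' f (-1) p := by
  have hcompl : {p | S.IntertwinesAt S' f 1 p} = {p | S.IntertwinesAt S' f (-1) p}ᶜ := by
    ext p
    exact ⟨fun h h' => S.not_intertwinesAt_both S' f p h h',
      fun h => (S.intertwinesAt_or S' f hdim hplanes p).resolve_right h⟩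
  have hclopen : IsClopen {p | S.IntertwinesAt S' f 1 p} :=
    ⟨S.isClosed_intertwinesAt S' f 1, by
      rw [hcompl]; exact (S.isClosed_intertwinesAt S' f (-1)).isOpen_compl⟩
  rcases isClopen_iff.1 hclopen with h | h
  · right
    intro p
    by_contra hp
    have : p ∈ {p | S.IntertwinesAt S' f 1 p} := by rw [hcompl]; exact hp
    rw [h] at this
    exact this
  · left
    intro p
    have : p ∈ {p | S.IntertwinesAt S' f 1 p} := by rw [h]; trivial
    exact this

/-- Eliminating the unknown factor turns conformality into the closed conditions `g'(v, w) g(a, a) =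
g'(a, a) g(v, w)`, with `g'` the pulled back metric; the factor is recovered from any nonisotropic
`a`. -/
theorem isClosed_conformalAt : IsClosed {p | ∃ c, S.ConformalAt S' f c p} := by
  refine isClosed_iff_frequently.2 fun p hp => ?_
  have hgood := eventually_isGoodChartPoint f.contMDiff p
  have hF := (contDiffAt_mapInCharts f.contMDiff p).continuousAt
  have hg := (S.contDiffAt_metricInChart p).continuousAt
  have hg' := (S'.contDiffAt_metricInChart (f p)).continuousAt
  rw [← mapInCharts_self (E := E) f p] at hg'
  have hg'F := hg'.comp hF
  have hA := continuousAt_fderiv_mapInCharts f p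
  set y₀ := extChartAt 𝓘(ℝ, E) p p with hy₀
  have hid : ∀ v w a : E, metricInChart S'.g (f p) (mapInCharts f p y₀)
      (fderiv ℝ (mapInCharts f p) y₀ v) (fderiv ℝ (mapInCharts f p) y₀ w)
        * metricInChart S.g p y₀ a a - metricInChart S'.g (f p) (mapInCharts f p y₀)
      (fderiv ℝ (mapInCharts f p) y₀ a) (fderiv ℝ (mapInCharts f p) y₀ a)
        * metricInChart S.g p y₀ v w = 0 := by
    intro v w a
    refine eq_zero_of_frequently_of_continuous (l := 𝓝 y₀)
      (F := fun y => metricInChart S'.g (f p) (mapInCharts f p y)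
        (fderiv ℝ (mapInCharts f p) y v) (fderiv ℝ (mapInCharts f p) y w)
        * metricInChart S.g p y a a - metricInChart S'.g (f p) (mapInCharts f p y)
      (fderiv ℝ (mapInCharts f p) y a) (fderiv ℝ (mapInCharts f p) y a)
        * metricInChart S.g p y v w) le_rfl ?_
      (((frequently_chart hp).and_eventually hgood).mono fun y ⟨h1, h2⟩ => ?_)
    · have e' : ∀ v w : E, ContinuousAt (fun y => metricInChart S'.g (f p) (mapInCharts f p y)
        (fderiv ℝ (mapInCharts f p) y v) (fderiv ℝ (mapInCharts f p) y w)) y₀ := fun v w =>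
        (hg'F.clm_apply (hA.clm_apply continuousAt_const)).clm_apply
          (hA.clm_apply continuousAt_const)
      have e : ∀ v w : E, ContinuousAt (fun y => metricInChart S.g p y v w) y₀ := fun v w =>
        (hg.clm_apply continuousAt_const).clm_apply continuousAt_const
      exact ((e' v w).mul (e a a)).sub ((e' a a).mul (e v w))
    · obtain ⟨c, hc⟩ := h1
      have hc' := (S.conformalAt_iff S' h2 c).1 hc
      simp only [hc']
      ring
  obtain ⟨x, hx⟩ := S.exists_g_ne_zero ((extChartAt 𝓘(ℝ, E) p).symm y₀)
  obtain ⟨a, rfl⟩ := (chartFrame_bijective p (mem_extChartAt_target p)).2 x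
  have ha : metricInChart S.g p y₀ a a ≠ 0 := hx
  have h0 := (S.conformalAt_iff S' hgood.self_of_nhds (metricInChart S'.g (f p) (mapInCharts f p y₀)
      (fderiv ℝ (mapInCharts f p) y₀ a) (fderiv ℝ (mapInCharts f p) y₀ a)
        / metricInChart S.g p y₀ a a)).2 (fun v w => by
    have := hid v w a
    field_simp
    linear_combination this)
  rw [extChartAt_to_inv] at h0
  exact ⟨_, h0⟩

/-- At a point of nonconstant holomorphic sectional curvature, the ratio condition forces `f` to be
conformal. -/
theorem exists_conformalAt {p : M} {ε : ℝ} (hε : ε * ε = 1) (hint : S.IntertwinesAt S' f ε p)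
    (hratio : ∀ ξ : TangentSpace 𝓘(ℝ, E) p, S.IsIsotropic p ξ → S.HolCurvRatioTendsToOne S' f p ξ)
    (hnc : ¬ S.HasConstantHolCurvAt p) : ∃ c, S.ConformalAt S' f c p := by
  let A : E →L[ℝ] E := mfderiv 𝓘(ℝ, E) 𝓘(ℝ, E) f p
  let g : E →L[ℝ] E →L[ℝ] ℝ := S.g p
  let g₁ : E →L[ℝ] E →L[ℝ] ℝ := S'.g (f p)
  let J : E →L[ℝ] E := S.J p
  let J₁ : E →L[ℝ] E := S'.J (f p)
  have hAJ : ∀ x, A (J x) = ε • J₁ (A x) := hint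
  have hg₁J : ∀ x y, g₁ (J₁ x) (J₁ y) = g₁ x y := S'.g_J (f p)
  have hH : ∀ x : E, S.holCurv p x = S.holQuartic p x / g x x ^ 2 := S.holCurv_eq p
  have hH' : ∀ x : E, S'.holCurv (f p) (A x) = S'.holQuartic (f p) (A x) / g₁ (A x) (A x) ^ 2 :=
    fun x => S'.holCurv_eq (f p) (A x)
  have key := exists_eq_mul_of_ratio_tendsto_one (g := g) (g' := g₁.bilinearComp A A) (J := J)
    (P := S.holQuartic p) (P' := fun x => S'.holQuartic (f p) (A x))
    (S.isQuartic_holQuartic p) (S.continuous_holQuartic p)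
    ((S'.continuous_holQuartic (f p)).comp A.continuous) (S.g_symm p)
    (fun x y => S'.g_symm (f p) (A x) (A y)) (S.g_nondegenerate p) (S.g_pos p) (S.g_neg p)
    (S.J_sq p) (S.g_J p)
    -- The pulled back metric is Hermitian for `J` whichever sign occurs, because `ε² = 1`.
    (fun x y => by
      simp only [ContinuousLinearMap.bilinearComp_apply, hAJ, map_smul, smul_apply, hg₁J,
        smul_eq_mul]
      linear_combination g₁ (A x) (A y) * hε)
    (fun ξ h0 hξ => by
      have h := hratio ξ ⟨h0, hξ⟩
      have h' : Tendsto (fun x : E => S'.holCurv (f p) (A x) / S.holCurv p x)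
        (𝓝[{x : E | g x x ≠ 0 ∧ g₁ (A x) (A x) ≠ 0 ∧ S.holCurv p x ≠ 0}] ξ) (𝓝 1) := h
      simp only [hH, hH'] at h'
      exact h')
    (fun ⟨c, hc⟩ => hnc ⟨c, fun x hx => (hH x).trans (hc x hx)⟩)
  exact key

/-- The differential of the conformal factor of `f` vanishes. -/
theorem hasFDerivAt_conformalFactor (hdim : 2 < Module.finrank ℝ E) {ε : ℝ} (hε : ε * ε = 1)
    (hint : ∀ p, S.IntertwinesAt S' f ε p) {c : M → ℝ} (hc : ∀ p, S.ConformalAt S' f (c p) p)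
    (p : M) : HasFDerivAt (fun y : E => c ((extChartAt 𝓘(ℝ, E) p).symm y)) (0 : E →L[ℝ] ℝ)
      (extChartAt 𝓘(ℝ, E) p p) := by
  have hgood := eventually_isGoodChartPoint f.contMDiff p
  have hG := S.isRegularAt_metricInChart p
  have hG' := S'.isRegularAt_metricInChart (f p)
  have hF := contDiffAt_mapInCharts_three f p
  have hJ := (S.contDiffAt_endInChart p).differentiableAt (by simp)
  have hJ' := (S'.contDiffAt_endInChart (f p)).differentiableAt (by simp)
  have hpar := S.J_parallel p
  have hpar' := S'.J_parallel (f p)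
  have hmem := mem_extChartAt_target (I := 𝓘(ℝ, E)) p
  have hmem' := mem_extChartAt_target (I := 𝓘(ℝ, E)) (f p)
  rw [← mapInCharts_self (E := E) f p] at hG' hJ' hpar' hmem'
  set y₀ := extChartAt 𝓘(ℝ, E) p p with hy₀
  let C : E → ℝ := fun y => c ((extChartAt 𝓘(ℝ, E) p).symm y)
  have hpull : ∀ᶠ y in 𝓝 y₀, ∀ v w, metricInChart S'.g (f p) (mapInCharts f p y)
      (fderiv ℝ (mapInCharts f p) y v) (fderiv ℝ (mapInCharts f p) y w) =
      C y * metricInChart S.g p y v w :=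
    hgood.mono fun y hy => (S.conformalAt_iff S' hy _).1 (hc _)
  -- Near `y₀` the factor is the quotient of the two metrics on a fixed vector that is nonisotropic
  -- at `y₀`.
  have hCd : DifferentiableAt ℝ C y₀ := by
    obtain ⟨x, hx⟩ := S.exists_g_ne_zero ((extChartAt 𝓘(ℝ, E) p).symm y₀)
    obtain ⟨a, rfl⟩ := (chartFrame_bijective p hmem).2 x
    have ha : metricInChart S.g p y₀ a a ≠ 0 := hx
    have ha' : (fun y => metricInChart S.g p y a a) y₀ ≠ 0 := ha
    have hGa : DifferentiableAt ℝ (fun y => metricInChart S.g p y a a) y₀ :=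
      (hG.differentiableAt.clm_apply (differentiableAt_const a)).clm_apply (differentiableAt_const a)
    obtain ⟨D, hD, -⟩ := LocalMetric.hasFDerivAt_pullback hG'.differentiableAt
      (hF.differentiableAt (by simp))
      ((hF.fderiv_right (m := 1) (by norm_num)).differentiableAt (by simp)) a a
    refine (hD.differentiableAt.mul (hGa.inv ha')).congr_of_eventuallyEq ?_
    filter_upwards [hpull, hGa.continuousAt.eventually_ne ha'] with y h1 h2
    simp only [Pi.mul_apply, Pi.inv_apply]
    rw [h1, mul_assoc, mul_inv_cancel₀ h2, mul_one]
  have hΩ : ∀ᶠ y in 𝓝 y₀, ∀ v w,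
      LocalMetric.fundamentalForm (metricInChart S'.g (f p)) (endInChart S'.J (f p))
        (mapInCharts f p y) (fderiv ℝ (mapInCharts f p) y v) (fderiv ℝ (mapInCharts f p) y w) =
      (ε * C y) * LocalMetric.fundamentalForm (metricInChart S.g p) (endInChart S.J p) y v w := by
    filter_upwards [hgood, hpull] with y h1 h2 v w
    have h3 := (S.intertwinesAt_iff S' h1 ε).1 (hint _) v
    have h4 : endInChart S'.J (f p) (mapInCharts f p y) (fderiv ℝ (mapInCharts f p) y v) =
        ε • fderiv ℝ (mapInCharts f p) y (endInChart S.J p y v) := by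
      rw [h3, smul_smul, hε, one_smul]
    change metricInChart S'.g (f p) (mapInCharts f p y) (endInChart S'.J (f p) (mapInCharts f p y)
      (fderiv ℝ (mapInCharts f p) y v)) (fderiv ℝ (mapInCharts f p) y w) =
      (ε * C y) * metricInChart S.g p y (endInChart S.J p y v) w
    rw [h4, map_smul, smul_apply, h2, smul_eq_mul, mul_assoc]
  have hεC : DifferentiableAt ℝ (fun y => ε * C y) y₀ := hCd.const_mul ε
  have hwedge := LocalMetric.wedge_fundamentalForm_eq_zero hG hG' hJ hJ' hF hεC
    (S.endInChart_skew p hmem) (S'.endInChart_skew (f p) hmem') hpar hpar' hΩ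
  have hzero : ∀ u, fderiv ℝ (fun y => ε * C y) y₀ u = 0 := by
    let Ω := LocalMetric.fundamentalForm (metricInChart S.g p) (endInChart S.J p) y₀
    refine eq_zero_of_wedge_eq_zero hdim
      (ContinuousLinearMap.coeLM ℝ ∘ₗ Ω.toLinearMap) ?_
      (fderiv ℝ (fun y => ε * C y) y₀).toLinearMap hwedge
    intro v hv
    have h1 : endInChart S.J p y₀ v = 0 := S.metricInChart_nondegenerate p hmem hv
    have h2 := S.endInChart_sq p hmem v
    rw [h1, map_zero] at h2
    exact neg_eq_zero.1 h2.symm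
  have hfin : HasFDerivAt (fun y => ε * (ε * C y)) (ε • (0 : E →L[ℝ] ℝ)) y₀ := by
    have h1 := hεC.hasFDerivAt
    rw [show fderiv ℝ (fun y => ε * C y) y₀ = 0 from ContinuousLinearMap.ext hzero] at h1
    exact h1.const_mul ε
  rw [smul_zero] at hfin
  refine hfin.congr_of_eventuallyEq (Eventually.of_forall fun y => ?_)
  change C y = ε * (ε * C y)
  rw [← mul_assoc, hε, one_mul]

/-- A homothety multiplies the quartic curvature form by its factor. -/
theorem holQuartic_map_eq {ε c : ℝ} (hε : ε * ε = 1) (hint : ∀ p, S.IntertwinesAt S' f ε p)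
    (hc : ∀ p, S.ConformalAt S' f c p) (p : M) (x : E) :
    S'.holQuartic (f p) (mfderiv 𝓘(ℝ, E) 𝓘(ℝ, E) f p x) = c * S.holQuartic p x := by
  have := FiniteDimensional.complete ℝ E
  have hgood := eventually_isGoodChartPoint f.contMDiff p
  have hG := S.isRegularAt_metricInChart p
  have hG' := S'.isRegularAt_metricInChart (f p)
  have hF := contDiffAt_mapInCharts_three f p
  let A : E →L[ℝ] E := mfderiv 𝓘(ℝ, E) 𝓘(ℝ, E) f p
  let J : E →L[ℝ] E := S.J p
  let J₁ : E →L[ℝ] E := S'.J (f p)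
  have hAJ : ∀ x, A (J x) = ε • J₁ (A x) := hint p
  have hJA : J₁ (A x) = ε • A (J x) := by rw [hAJ, smul_smul, hε, one_smul]
  have hA : ∀ v, fderiv ℝ (mapInCharts f p) (extChartAt 𝓘(ℝ, E) p p) v = A v :=
    fderiv_mapInCharts_self p f.contMDiff
  have hpull : ∀ᶠ y in 𝓝 (extChartAt 𝓘(ℝ, E) p p), ∀ v w,
      metricInChart S'.g (f p) (mapInCharts f p y)
      (fderiv ℝ (mapInCharts f p) y v) (fderiv ℝ (mapInCharts f p) y w) =
      c * metricInChart S.g p y v w :=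
    hgood.mono fun y hy => (S.conformalAt_iff S' hy _).1 (hc _)
  have hsurj : ∀ᶠ y in 𝓝 (extChartAt 𝓘(ℝ, E) p p),
      Function.Surjective (fderiv ℝ (mapInCharts f p) y) :=
    hgood.mono fun y hy => fderiv_mapInCharts_surjective hy (mfderiv_bijective f _).2
  rw [← mapInCharts_self (E := E) f p] at hG'
  have hR := LocalMetric.fderiv_apply_curvatureOperator hG hG' hF hsurj hpull x (J x) (J x)
  have hg := hpull.self_of_nhds (LocalMetric.curvatureOperator (metricInChart S.g p)
    (extChartAt 𝓘(ℝ, E) p p) x (J x) (J x)) x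
  rw [hR] at hg
  simp only [hA] at hg
  have h1 := S'.curvatureTensor_eq (f p) (A x) (J₁ (A x)) (J₁ (A x)) (A x)
  have h2 := S.curvatureTensor_eq p x (J x) (J x) x
  have h3 : S.holQuartic p x = _ := h2
  have h4 : S'.holQuartic (f p) (A x) = _ := h1
  -- The structure `J` occurs twice in the quartic, so the signs multiply to `ε² = 1`.
  rw [← mapInCharts_self (E := E) f p, hJA, hG'.curvatureOperator_eq] at h4
  rw [hG'.curvatureOperator_eq] at hg
  refine h4.trans ?_
  rw [h3, ← hg]
  simp only [map_smul, map_add, map_sub, smul_apply, smul_smul, hε, one_smul, add_apply, sub_apply]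

/-- A homothety turns `P / g²` into `c P / (c g)²`, so the ratio is constantly `1 / c` where it is
defined. Nonconstancy of `H` supplies an isotropic vector approached by such points, so that the
limit there is not vacuous. -/
theorem homothety_factor_eq_one {ε c : ℝ} (hε : ε * ε = 1) (hint : ∀ p, S.IntertwinesAt S' f ε p)
    (hc : ∀ p, S.ConformalAt S' f c p) {p : M} (hnc : ¬ S.HasConstantHolCurvAt p)
    (hratio : ∀ ξ : TangentSpace 𝓘(ℝ, E) p, S.IsIsotropic p ξ →
      S.HolCurvRatioTendsToOne S' f p ξ) : c = 1 := by
  let A : E →L[ℝ] E := mfderiv 𝓘(ℝ, E) 𝓘(ℝ, E) f p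
  let g : E →L[ℝ] E →L[ℝ] ℝ := S.g p
  let g₁ : E →L[ℝ] E →L[ℝ] ℝ := S'.g (f p)
  have hH : ∀ x : E, S.holCurv p x = S.holQuartic p x / g x x ^ 2 := S.holCurv_eq p
  have hH' : ∀ x : E, S'.holCurv (f p) (A x) = S'.holQuartic (f p) (A x) / g₁ (A x) (A x) ^ 2 :=
    fun x => S'.holCurv_eq (f p) (A x)
  have hgA : ∀ x y, g₁ (A x) (A y) = c * g x y := hc p
  have hc0 : c ≠ 0 := by
    rintro rfl
    obtain ⟨u, hu⟩ := S'.g_pos (f p)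
    obtain ⟨x, rfl⟩ := (mfderiv_bijective f p).2 u
    rw [hc p x x, zero_mul] at hu
    exact lt_irrefl _ hu
  obtain ⟨ξ, hξ, hξ0, hfr⟩ := exists_isotropic_frequently_ne_zero (g := g)
    (S.isQuartic_holQuartic p) (S.g_symm p) (S.g_pos p) (S.g_neg p)
    (fun ⟨c, hc⟩ => hnc ⟨c, fun x hx => (hH x).trans (hc x hx)⟩)
  have h : Tendsto (fun x : E => S'.holCurv (f p) (A x) / S.holCurv p x)
    (𝓝[{x : E | g x x ≠ 0 ∧ g₁ (A x) (A x) ≠ 0 ∧ S.holCurv p x ≠ 0}] ξ) (𝓝 1) :=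
    hratio ξ ⟨hξ, hξ0⟩
  have hne : (𝓝[{x : E | g x x ≠ 0 ∧ g₁ (A x) (A x) ≠ 0 ∧ S.holCurv p x ≠ 0}] ξ).NeBot := by
    rw [← mem_closure_iff_nhdsWithin_neBot, mem_closure_iff_frequently]
    refine hfr.mono fun x ⟨h1, h2⟩ => ⟨h1, ?_, ?_⟩
    · rw [hgA]; exact mul_ne_zero hc0 h1
    · rw [hH]; exact div_ne_zero h2 (pow_ne_zero 2 h1)
  have hconst : Tendsto (fun x : E => S'.holCurv (f p) (A x) / S.holCurv p x)
      (𝓝[{x : E | g x x ≠ 0 ∧ g₁ (A x) (A x) ≠ 0 ∧ S.holCurv p x ≠ 0}] ξ) (𝓝 c⁻¹) := by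
    refine tendsto_const_nhds.congr' ?_
    filter_upwards [self_mem_nhdsWithin] with x ⟨h1, h2, h3⟩
    have h4 : S'.holQuartic (f p) (A x) = c * S.holQuartic p x :=
      S.holQuartic_map_eq S' f hε hint hc p x
    rw [hH] at h3
    have h5 : S.holQuartic p x ≠ 0 := fun h0 => h3 (by rw [h0, zero_div])
    rw [hH, hH', hgA, h4]
    field_simp
  have := tendsto_nhds_unique h hconst
  rw [← inv_inv c, ← this, inv_one]

end IndefiniteKahler

end

theorem theorem2 (n : ℕ) (hn : 2 ≤ n)
    {M : Type*} [TopologicalSpace M] [ChartedSpace (EuclideanSpace ℝ (Fin (2 * n))) M]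
    [IsManifold (𝓡 (2 * n)) ∞ M] [T2Space M] [SecondCountableTopology M] [ConnectedSpace M]
    {M' : Type*} [TopologicalSpace M'] [ChartedSpace (EuclideanSpace ℝ (Fin (2 * n))) M']
    [IsManifold (𝓡 (2 * n)) ∞ M'] [T2Space M'] [SecondCountableTopology M'] [ConnectedSpace M']
    (S : IndefiniteKahler (EuclideanSpace ℝ (Fin (2 * n))) M)
    (S' : IndefiniteKahler (EuclideanSpace ℝ (Fin (2 * n))) M')
    (f : M ≃ₘ^∞⟮𝓡 (2 * n), 𝓡 (2 * n)⟯ M')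
    (hplanes : S.MapsHolomorphicPlanes S' f)
    (hratio : ∀ (p : M) (ξ : TangentSpace (𝓡 (2 * n)) p), S.IsIsotropic p ξ →
      S.HolCurvRatioTendsToOne S' f p ξ)
    (hnonconst : Dense {p : M | ¬ S.HasConstantHolCurvAt p}) :
    (S.IsHolomorphic S' f ∨ S.IsAntiholomorphic S' f) ∧ S.IsMetricPreserving S' f := by
  have hdim : 2 < Module.finrank ℝ (EuclideanSpace ℝ (Fin (2 * n))) := by
    rw [finrank_euclideanSpace_fin]; omega
  have hmetric : ∀ ε : ℝ, ε * ε = 1 → (∀ p, S.IntertwinesAt S' f ε p) →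
      S.IsMetricPreserving S' f := by
    intro ε hε hint
    have hconf : ∀ p, ∃ c, S.ConformalAt S' f c p := by
      intro p
      -- Conformality is known only where `H` is not constant; closedness and density extend it to
      -- every point.
      have hcl : closure {p : M | ¬ S.HasConstantHolCurvAt p} ⊆
          {p | ∃ c, S.ConformalAt S' f c p} :=
        closure_minimal (fun q hq => S.exists_conformalAt S' f hε (hint q) (hratio q) hq)
          (S.isClosed_conformalAt S' f)
      exact hcl (hnonconst p)
    choose c hc using hconf
    obtain ⟨p₀, hp₀⟩ := hnonconst.nonempty
    have hcc : ∀ p, S.ConformalAt S' f (c p₀) p := by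
      intro p
      rw [eq_of_hasFDerivAt_zero_in_charts
        (S.hasFDerivAt_conformalFactor S' f hdim hε hint hc) p₀ p]
      exact hc p
    have h1 := S.homothety_factor_eq_one S' f hε hint hcc hp₀ (hratio p₀)
    intro p x y
    rw [hcc p x y, h1, one_mul]
  rcases S.intertwines_or S' f hdim hplanes with h | h
  · exact ⟨Or.inl fun p x => by rw [h p x, one_smul], hmetric 1 (by norm_num) h⟩
  · exact ⟨Or.inr fun p x => by rw [h p x, neg_one_smul], hmetric (-1) (by norm_num) h⟩
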